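/- Let $\lambda>0$ and $0<\sigma<1$. Let $d\mu_\lambda(x)=(1-x^2)^{\lambda-1/2}\,dx$ on $(-1,1)$, let $C_n^\lambda$ be the ultraspherical (Gegenbauer) polynomial of degree $n$ and order $\lambda$, let $c_n^\lambda=C_n^\lambda/\|C_n^\lambda\|_{L^2(\mu_\lambda)}$, and for real-valued $f\in L^2(\mu_\lambda)$ let $a_n^\lambda(f)=\int_{-1}^1 f\,c_n^\lambda\,d\mu_\lambda$. Let $$H^\sigma_\lambda=\Big\{f\in L^2(\mu_\lambda):\ \sum_{n=0}^\infty (n+\lambda)^\sigma\,a_n^\lambda(f)^2<\infty\Big\},$$ $$A^\lambda_\sigma f=\sum_{n=0}^\infty \frac{\Gamma\big(n+\lambda+\frac{1+\sigma}{2}\big)}{\Gamma\big(n+\lambda+\frac{1-\sigma}{2}\big)}\,a_n^\lambda(f)\,c_n^\lambda .$$ For $u\in H^\sigma_\lambda$ let $\langle u,A^\lambda_\sigma u\rangle_\lambda=\lim_{N\to\infty}\int_{-1}^1 u\,S_N\,d\mu_\lambda$, where $S_N$ is the sum of the terms with $n<N$ of the series defining $A^\lambda_\sigma u$. Then for every $u\in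 H^\sigma_\lambda$ this limit exists and is finite, it equals $$\sum_{n=0}^\infty \frac{\Gamma\big(n+\lambda+\frac{1+\sigma}{2}\big)}{\Gamma\big(n+\lambda+\frac{1-\sigma}{2}\big)}\,a_n^\lambda(u)^2,$$ it equals the integral $\int_{-1}^1 u\,A^\lambda_\sigma u\,d\mu_\lambda$ whenever the series defining $A^\lambda_\sigma u$ converges in $L^2(\mu_\lambda)$, the function $u^2(1-x^2)^{-\sigma/2}$ is $\mu_\lambda$-integrable, and $$Q_{\sigma,\lambda}\int_{-1}^{1}\frac{u(x)^2}{(1-x^2)^{\sigma/2}}\,d\mu_\lambda(x)\ \le\ \langle u,A^\lambda_\sigma u\rangle_\lambda,\qquad Q_{\sigma,\lambda}=2^\sigma\,\frac{\Gamma\big(\frac{\lambda}{2}+\frac{1+\sigma}{4}\big)^2}{\Gamma\big(\frac{\lambda}{2}+\frac{1-\sigma}{4}\big)^2}.$$ -/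

import Mathlib

open MeasureTheory Filter Topology
open scoped Polynomial

noncomputable section

/-- The ultraspherical (Gegenbauer) polynomial `C_n^lam` of degree `n` and order `lam`, by its
three-term recurrence
`(n + 2) C_{n+2} = 2 (n + 1 + lam) X C_{n+1} - (n + 2 lam) C_n`, `C_0 = 1`, `C_1 = 2 lam X`. -/
def ultraPoly (lam : ℝ) : ℕ → ℝ[X]
  | 0 => 1
  | 1 => Polynomial.C (2 * lam) * Polynomial.X
  | (n + 2) =>
      Polynomial.C (2 * ((n : ℝ) + 1 + lam) / ((n : ℝ) + 2)) * Polynomial.X * ultraPoly lam (n + 1)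
        - Polynomial.C (((n : ℝ) + 2 * lam) / ((n : ℝ) + 2)) * ultraPoly lam n

/-- The measure `(1 - x ^ 2) ^ (lam - 1 / 2) dx` on the interval `(-1, 1)`. -/
def ultraMeasure (lam : ℝ) : Measure ℝ :=
  (volume.restrict (Set.Ioo (-1 : ℝ) 1)).withDensity
    (fun x => ENNReal.ofReal ((1 - x ^ 2) ^ (lam - 1 / 2)))

/-- The pairing `⟨f, g⟩ = ∫ f g` with respect to the ultraspherical measure. -/
def ultraInner (lam : ℝ) (f g : ℝ → ℝ) : ℝ :=
  ∫ x, f x * g x ∂(ultraMeasure lam)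

/-- The norm `d_n` of `C_n^lam` in `L^2` of the ultraspherical measure. -/
def ultraPolyNorm (lam : ℝ) (n : ℕ) : ℝ :=
  Real.sqrt (∫ x, ((ultraPoly lam n).eval x) ^ 2 ∂(ultraMeasure lam))

/-- The orthonormal ultraspherical polynomials `c_n^lam = C_n^lam / d_n`. -/
def ultraBasis (lam : ℝ) (n : ℕ) (x : ℝ) : ℝ :=
  (ultraPoly lam n).eval x / ultraPolyNorm lam n

/-- The Fourier coefficients `a_n^lam(f)`. -/
def ultraCoeff (lam : ℝ) (f : ℝ → ℝ) (n : ℕ) : ℝ :=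
  ultraInner lam f (ultraBasis lam n)

/-- The ultraspherical Sobolev space of order `σ`: the `f` in `L^2` of the ultraspherical measure
with `∑ (n + lam) ^ σ a_n(f) ^ 2 < ∞`. -/
def ultraSobolev (lam σ : ℝ) : Set (ℝ → ℝ) :=
  {f | MemLp f 2 (ultraMeasure lam) ∧
    Summable fun n : ℕ => ((n : ℝ) + lam) ^ σ * ultraCoeff lam f n ^ 2}

/-- The spectral multiplier of the operator `A_σ^lam`. -/
def ultraMultiplier (lam σ : ℝ) (n : ℕ) : ℝ :=
  Real.Gamma ((n : ℝ) + lam + (1 + σ) / 2) / Real.Gamma ((n : ℝ) + lam + (1 - σ) / 2)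

/-- The partial sums, over `n < N`, of the series
`A_σ^lam f = ∑ ultraMultiplier n * a_n(f) * c_n`. -/
def ultraOpPartial (lam σ : ℝ) (f : ℝ → ℝ) (N : ℕ) (x : ℝ) : ℝ :=
  ∑ n ∈ Finset.range N, ultraMultiplier lam σ n * ultraCoeff lam f n * ultraBasis lam n x

/-- `v` is the function `A_σ^lam f`: the series defining `A_σ^lam f` converges to `v` in `L^2` of
the ultraspherical measure. -/
def IsUltraOp (lam σ : ℝ) (f v : ℝ → ℝ) : Prop :=
  MemLp v 2 (ultraMeasure lam) ∧
    Tendsto (fun N : ℕ => eLpNorm (fun x => ultraOpPartial lam σ f N x - v x) 2 (ultraMeasure lam))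
      atTop (𝓝 0)

/-- The constant `Q_{σ, lam}`. -/
def ultraHardyConst (lam σ : ℝ) : ℝ :=
  (2 : ℝ) ^ σ * Real.Gamma (lam / 2 + (1 + σ) / 4) ^ 2 / Real.Gamma (lam / 2 + (1 - σ) / 4) ^ 2

end

/-!
Write `m_n` for the multiplier of `A = A_σ^λ`, `V = (1 - x²) ^ (-σ / 2)` and `Q` for the constant.
The proof is a Schur test for the positive operator `A⁻¹`, carried out on polynomials, followed by
duality.

The inverse `A⁻¹` preserves positivity: by the Beta integral, `m_n⁻¹` is an average of `r ^ n` over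
`r ∈ (0, 1)` with positive weight, and the Poisson semigroup `C_n ↦ r ^ n C_n` preserves positivity
by the maximum principle (`poisson_nonneg`, `inverse_nonneg`).

The function `w = (1 - x²) ^ (-(2λ + 1 - σ) / 4)` is a ground state, `A w = Q V w`. Only the
resulting relation between the Fourier coefficients of `w` and of the integrable function `V w` is
needed (`ultraCoeff_groundState`). It follows from a two-step recurrence in `n` for
`∫ C_n (1 - x²) ^ β`, which comes from integration by parts, and from the Beta integral for `n = 0`.

For polynomials `g`, `φ`, `q` with `q > 0` and `g² ≤ φ q`, the polynomial `φ - 2 t g + t² q` is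
nonnegative for all real `t`; applying `A⁻¹`, choosing `t = g(x) / q(x)` at each point `x` and
integrating gives `⟨g, A⁻¹ g⟩ ≤ ⟨φ, A⁻¹ q⟩`. If moreover `q ≤ V w`, then
`⟨φ, A⁻¹ q⟩ ≤ ⟨A⁻¹ φ, V w⟩ = Q⁻¹ ⟨φ, w⟩` (`sum_sq_div_multiplier_le`). Letting `q` approach `V w`
and `φ` approach `g² / (V w)` yields `Q ⟨g, A⁻¹ g⟩ ≤ ∫ g² / V` (`dual_inequality_polynomial`).

By the Cauchy-Schwarz inequality for finite sums, `Q (∫ u g)² ≤ E ∫ g² / V` where `E = ∑ m_n a_n²`,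
first for polynomials and then for all `g` in `L²` by density (`sq_integral_mul_le`). Truncations of
`g = V u` give the Hardy inequality.
-/

namespace Ultraspherical

/-! ### Algebraic identities for the ultraspherical polynomials -/

theorem eval_recurrence (lam : ℝ) (n : ℕ) (x : ℝ) :
    ((n : ℝ) + 2) * (ultraPoly lam (n + 2)).eval x =
      2 * ((n : ℝ) + 1 + lam) * x * (ultraPoly lam (n + 1)).eval x
        - ((n : ℝ) + 2 * lam) * (ultraPoly lam n).eval x := by
  have h : (n : ℝ) + 2 ≠ 0 := by positivity
  simp only [ultraPoly, Polynomial.eval_sub, Polynomial.eval_mul, Polynomial.eval_C,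
    Polynomial.eval_X]
  field_simp

theorem eval_derivative_recurrence (lam : ℝ) (n : ℕ) (x : ℝ) :
    ((n : ℝ) + 2) * (ultraPoly lam (n + 2)).derivative.eval x =
      2 * ((n : ℝ) + 1 + lam) * ((ultraPoly lam (n + 1)).eval x
          + x * (ultraPoly lam (n + 1)).derivative.eval x)
        - ((n : ℝ) + 2 * lam) * (ultraPoly lam n).derivative.eval x := by
  have h : (n : ℝ) + 2 ≠ 0 := by positivity
  rw [ultraPoly]
  simp only [Polynomial.derivative_sub, Polynomial.derivative_mul, Polynomial.derivative_C,
    Polynomial.derivative_X, Polynomial.eval_sub, Polynomial.eval_add, Polynomial.eval_mul,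
    Polynomial.eval_C, Polynomial.eval_X, Polynomial.eval_one, Polynomial.eval_zero]
  field_simp
  ring

/-- The lowering relation `(1 - x²) C_{n+1}' = (n + 2λ) C_n - (n + 1) x C_{n+1}`. -/
theorem one_sub_sq_mul_derivative_succ (lam : ℝ) (n : ℕ) (x : ℝ) :
    (1 - x ^ 2) * (ultraPoly lam (n + 1)).derivative.eval x =
      ((n : ℝ) + 2 * lam) * (ultraPoly lam n).eval x
        - ((n : ℝ) + 1) * x * (ultraPoly lam (n + 1)).eval x := by
  induction n using Nat.twoStepInduction with
  | zero =>
    simp [ultraPoly]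
    ring
  | one =>
    simp [ultraPoly]
    ring
  | more n ih0 ih1 =>
    have hr := eval_recurrence lam (n + 1) x
    have hr0 := eval_recurrence lam n x
    have hd := eval_derivative_recurrence lam (n + 1) x
    have hne : (n : ℝ) + 3 ≠ 0 := by positivity
    apply mul_left_cancel₀ hne
    push_cast at *
    simp only [add_assoc, Nat.reduceAdd] at *
    linear_combination (1 - x ^ 2) * hd + 2 * (n + 2 + lam) * x * ih1 - (n + 1 + 2 * lam) * ih0
      + (n + 3) * x * hr - (n + 1 + 2 * lam) * hr0

/-- The raising relation `(1 - x²) C_n' = (n + 2λ) x C_n - (n + 1) C_{n+1}`. -/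
theorem one_sub_sq_mul_derivative (lam : ℝ) (n : ℕ) (x : ℝ) :
    (1 - x ^ 2) * (ultraPoly lam n).derivative.eval x =
      ((n : ℝ) + 2 * lam) * x * (ultraPoly lam n).eval x
        - ((n : ℝ) + 1) * (ultraPoly lam (n + 1)).eval x := by
  cases n with
  | zero => simp [ultraPoly]
  | succ n =>
    have h := one_sub_sq_mul_derivative_succ lam n x
    have hr := eval_recurrence lam n x
    push_cast
    linear_combination h + hr

/-- The derivatives of consecutive ultraspherical polynomials satisfy
`C_{n+1}' = x C_n' + (n + 2λ) C_n`. -/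
theorem derivative_succ (lam : ℝ) (n : ℕ) :
    (ultraPoly lam (n + 1)).derivative = Polynomial.X * (ultraPoly lam n).derivative
      + Polynomial.C ((n : ℝ) + 2 * lam) * ultraPoly lam n := by
  have hne : (1 - Polynomial.X ^ 2 : ℝ[X]) ≠ 0 := by
    intro h
    simpa using congrArg (Polynomial.eval 0) h
  apply mul_left_cancel₀ hne
  refine Polynomial.funext fun x => ?_
  have h := one_sub_sq_mul_derivative_succ lam n x
  have h' := one_sub_sq_mul_derivative lam n x
  simp only [Polynomial.eval_mul, Polynomial.eval_sub, Polynomial.eval_add, Polynomial.eval_one,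
    Polynomial.eval_pow, Polynomial.eval_X, Polynomial.eval_C]
  linear_combination h - x * h'

/-- The ultraspherical differential equation
`(1 - x²) C_n'' - (2λ + 1) x C_n' + n (n + 2λ) C_n = 0`. -/
theorem differential_equation (lam : ℝ) (n : ℕ) (x : ℝ) :
    (1 - x ^ 2) * (ultraPoly lam n).derivative.derivative.eval x
      - (2 * lam + 1) * x * (ultraPoly lam n).derivative.eval x
      + n * (n + 2 * lam) * (ultraPoly lam n).eval x = 0 := by
  have h : (1 - Polynomial.X ^ 2 : ℝ[X]) * (ultraPoly lam n).derivative =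
      Polynomial.C ((n : ℝ) + 2 * lam) * Polynomial.X * ultraPoly lam n
        - Polynomial.C ((n : ℝ) + 1) * ultraPoly lam (n + 1) := by
    refine Polynomial.funext fun y => ?_
    simpa using one_sub_sq_mul_derivative lam n y
  have h' := congrArg (Polynomial.eval x ∘ Polynomial.derivative) h
  have hs := congrArg (Polynomial.eval x) (derivative_succ lam n)
  simp at h' hs
  linear_combination h' - (n + 1) * hs

theorem natDegree_le_and_coeff_pos {lam : ℝ} (hlam : 0 < lam) (n : ℕ) :
    (ultraPoly lam n).natDegree ≤ n ∧ 0 < (ultraPoly lam n).coeff n := by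
  induction n using Nat.twoStepInduction with
  | zero => simp [ultraPoly]
  | one =>
    refine ⟨(Polynomial.natDegree_C_mul_le _ _).trans Polynomial.natDegree_X_le, ?_⟩
    simpa [ultraPoly] using hlam
  | more n ih0 ih1 =>
    have hc : (ultraPoly lam n).coeff (n + 2) = 0 :=
      Polynomial.coeff_eq_zero_of_natDegree_lt (by omega)
    constructor
    · rw [ultraPoly]
      refine (Polynomial.natDegree_sub_le _ _).trans (max_le ?_ ?_)
      · refine Polynomial.natDegree_mul_le.trans ?_
        have := (Polynomial.natDegree_C_mul_le (2 * ((n : ℝ) + 1 + lam) / ((n : ℝ) + 2))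
          Polynomial.X).trans Polynomial.natDegree_X_le
        omega
      · exact (Polynomial.natDegree_C_mul_le _ _).trans (by omega)
    · rw [ultraPoly, Polynomial.coeff_sub, Polynomial.coeff_C_mul, hc, mul_zero, sub_zero,
        mul_assoc, Polynomial.coeff_C_mul, show n + 2 = (n + 1) + 1 from rfl,
        Polynomial.coeff_X_mul]
      exact mul_pos (by positivity) ih1.2

theorem ultraPoly_ne_zero {lam : ℝ} (hlam : 0 < lam) (n : ℕ) : ultraPoly lam n ≠ 0 := by
  intro h
  have := (natDegree_le_and_coeff_pos hlam n).2
  simp [h] at this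

/-- Every polynomial is a linear combination of ultraspherical polynomials. -/
theorem exists_eq_sum_ultraPoly {lam : ℝ} (hlam : 0 < lam) (p : ℝ[X]) :
    ∃ (N : ℕ) (b : ℕ → ℝ), p = ∑ n ∈ Finset.range N, Polynomial.C (b n) * ultraPoly lam n := by
  suffices H : ∀ (N : ℕ) (p : ℝ[X]), (∀ m, N ≤ m → p.coeff m = 0) →
      ∃ b : ℕ → ℝ, p = ∑ n ∈ Finset.range N, Polynomial.C (b n) * ultraPoly lam n by
    obtain ⟨b, hb⟩ := H (p.natDegree + 1) p
      fun m hm => Polynomial.coeff_eq_zero_of_natDegree_lt (by omega)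
    exact ⟨_, b, hb⟩
  intro N
  induction N with
  | zero =>
    intro p hp
    refine ⟨0, ?_⟩
    ext m
    simp [hp m (Nat.zero_le m)]
  | succ N ih =>
    intro p hp
    obtain ⟨hdeg, hpos⟩ := natDegree_le_and_coeff_pos hlam N
    set c := p.coeff N / (ultraPoly lam N).coeff N
    obtain ⟨b, hb⟩ := ih (p - Polynomial.C c * ultraPoly lam N) (by
      intro m hm
      rcases hm.eq_or_lt with rfl | hm
      · simp [c, hpos.ne']
      · simp [hp m hm, Polynomial.coeff_eq_zero_of_natDegree_lt (hdeg.trans_lt hm)])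
    refine ⟨Function.update b N c, ?_⟩
    rw [Finset.sum_range_succ, Function.update_self, ← sub_eq_iff_eq_add, hb]
    refine Finset.sum_congr rfl fun n hn => ?_
    rw [Function.update_of_ne (Finset.mem_range.1 hn).ne]

/-! ### Integrals against powers of `1 - x²` -/

theorem intervalIntegrable_beta {a b : ℝ} (ha : 0 < a) (hb : 0 < b) :
    IntervalIntegrable (fun t : ℝ => t ^ (a - 1) * (1 - t) ^ (b - 1)) volume 0 1 := by
  have h := Complex.betaIntegral_convergent (u := a) (v := b) (by simpa) (by simpa)
  rw [intervalIntegrable_iff_integrableOn_Ioo_of_le zero_le_one] at h ⊢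
  refine h.re.congr ?_
  filter_upwards [ae_restrict_mem measurableSet_Ioo] with t ht
  have h1 : 0 ≤ 1 - t := by linarith [ht.2]
  rw [← Complex.ofReal_one, ← Complex.ofReal_sub, ← Complex.ofReal_sub, ← Complex.ofReal_sub,
    ← Complex.ofReal_cpow ht.1.le, ← Complex.ofReal_cpow h1, ← Complex.ofReal_mul]
  rfl

theorem integral_beta {a b : ℝ} (ha : 0 < a) (hb : 0 < b) :
    ∫ t in (0 : ℝ)..1, t ^ (a - 1) * (1 - t) ^ (b - 1) =
      Real.Gamma a * Real.Gamma b / Real.Gamma (a + b) := by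
  have h := ProbabilityTheory.beta_eq_betaIntegralReal a b ha hb
  rw [ProbabilityTheory.beta] at h
  rw [h, ← Complex.ofReal_re (∫ t in (0 : ℝ)..1, _), ← intervalIntegral.integral_ofReal,
    Complex.betaIntegral]
  congr 1
  refine intervalIntegral.integral_congr fun t ht => ?_
  rw [Set.uIcc_of_le zero_le_one] at ht
  have h1 : 0 ≤ 1 - t := by linarith [ht.2]
  rw [Complex.ofReal_mul, Complex.ofReal_cpow ht.1, Complex.ofReal_cpow h1]
  push_cast
  rfl

theorem one_sub_sq_rpow_eq {β x : ℝ} (hx : x ∈ Set.Icc (-1 : ℝ) 1) :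
    (1 - x ^ 2) ^ β = 4 ^ β * ((1 / 2 * x + 1 / 2) ^ β * (1 - (1 / 2 * x + 1 / 2)) ^ β) := by
  rw [← Real.mul_rpow (by linarith [hx.1]) (by linarith [hx.2]),
    ← Real.mul_rpow (by norm_num) (mul_nonneg (by linarith [hx.1]) (by linarith [hx.2]))]
  congr 1
  ring

theorem intervalIntegrable_one_sub_sq_rpow {β : ℝ} (hβ : -1 < β) :
    IntervalIntegrable (fun x : ℝ => (1 - x ^ 2) ^ β) volume (-1) 1 := by
  have h := intervalIntegrable_beta (a := β + 1) (b := β + 1) (by linarith) (by linarith)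
  simp only [add_sub_cancel_right] at h
  have h2 := ((h.comp_add_right (1 / 2)).comp_mul_left (c := 1 / 2)).const_mul (4 ^ β)
  norm_num at h2
  rw [intervalIntegrable_iff_integrableOn_Ioo_of_le (by norm_num)] at h2 ⊢
  refine h2.congr ?_
  filter_upwards [ae_restrict_mem measurableSet_Ioo] with x hx
  rw [one_sub_sq_rpow_eq ⟨hx.1.le, hx.2.le⟩]

theorem integral_one_sub_sq_rpow {β : ℝ} (hβ : -1 < β) :
    ∫ x in (-1 : ℝ)..1, (1 - x ^ 2) ^ β =
      2 * 4 ^ β * (Real.Gamma (β + 1) ^ 2 / Real.Gamma (2 * β + 2)) := by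
  have h := integral_beta (a := β + 1) (b := β + 1) (by linarith) (by linarith)
  simp only [add_sub_cancel_right] at h
  have h2 : ∫ x in (-1 : ℝ)..1, (1 - x ^ 2) ^ β = ∫ x in (-1 : ℝ)..1,
      (fun t : ℝ => 4 ^ β * (t ^ β * (1 - t) ^ β)) (1 / 2 * x + 1 / 2) := by
    refine intervalIntegral.integral_congr fun x hx => ?_
    rw [Set.uIcc_of_le (by norm_num)] at hx
    exact one_sub_sq_rpow_eq hx
  rw [h2, intervalIntegral.integral_comp_mul_add (c := (1 / 2 : ℝ))
    (fun t : ℝ => 4 ^ β * (t ^ β * (1 - t) ^ β)) (by norm_num) (1 / 2),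
    intervalIntegral.integral_const_mul]
  norm_num
  rw [h, ← two_mul]
  ring_nf

theorem intervalIntegrable_eval_mul {β : ℝ} (hβ : -1 < β) (p : ℝ[X]) :
    IntervalIntegrable (fun x : ℝ => p.eval x * (1 - x ^ 2) ^ β) volume (-1) 1 :=
  (intervalIntegrable_one_sub_sq_rpow hβ).continuousOn_mul p.continuous.continuousOn

/-- Integration by parts against a power of `1 - x²`: the integrand is the derivative of
`(1 - x²) ^ (β + 1) p`, which vanishes at both end points. -/
theorem integral_by_parts {β : ℝ} (hβ : -1 < β) (p : ℝ[X]) :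
    ∫ x in (-1 : ℝ)..1, ((1 - x ^ 2) * p.derivative.eval x - 2 * (β + 1) * x * p.eval x)
      * (1 - x ^ 2) ^ β = 0 := by
  have h := intervalIntegral.integral_eq_sub_of_hasDerivAt_of_le (a := -1) (b := 1)
    (f := fun x : ℝ => (1 - x ^ 2) ^ (β + 1) * p.eval x)
    (f' := fun x : ℝ => ((1 - x ^ 2) * p.derivative.eval x - 2 * (β + 1) * x * p.eval x)
      * (1 - x ^ 2) ^ β) (by norm_num) ?_ ?_ ?_
  · have hβ' : β + 1 ≠ 0 := by linarith
    rw [h]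
    simp [Real.zero_rpow hβ']
  · refine ContinuousOn.mul (ContinuousOn.rpow_const (by fun_prop) ?_) p.continuous.continuousOn
    exact fun x _ => Or.inr (by linarith)
  · intro x hx
    have hpos : 0 < 1 - x ^ 2 := by nlinarith [hx.1, hx.2]
    have h1 : HasDerivAt (fun x : ℝ => 1 - x ^ 2) (-(2 * x)) x := by
      simpa using ((hasDerivAt_id x).pow 2).const_sub 1
    convert! (h1.rpow_const (p := β + 1) (Or.inl hpos.ne')).mul (p.hasDerivAt x) using 1
    rw [add_sub_cancel_right, Real.rpow_add hpos, Real.rpow_one]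
    ring
  · convert! intervalIntegrable_eval_mul hβ ((1 - Polynomial.X ^ 2) * p.derivative
      - Polynomial.C (2 * (β + 1)) * Polynomial.X * p) using 2 with x
    simp

/-- The two-step recurrence for `∫ C_n (1 - x²) ^ β`. -/
theorem integral_ultraPoly_succ_succ (lam : ℝ) {β : ℝ} (hβ : -1 < β) (n : ℕ) :
    ((n : ℝ) + 2) * ((n : ℝ) + 2 * β + 3) *
        ∫ x in (-1 : ℝ)..1, (ultraPoly lam (n + 2)).eval x * (1 - x ^ 2) ^ β =
      ((n : ℝ) + 2 * lam - 2 * β - 1) * ((n : ℝ) + 2 * lam) *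
        ∫ x in (-1 : ℝ)..1, (ultraPoly lam n).eval x * (1 - x ^ 2) ^ β := by
  have hx := intervalIntegrable_eval_mul hβ (Polynomial.X * ultraPoly lam (n + 1))
  have h0 := intervalIntegrable_eval_mul hβ (ultraPoly lam n)
  have h2 := intervalIntegrable_eval_mul hβ (ultraPoly lam (n + 2))
  simp only [Polynomial.eval_mul, Polynomial.eval_X] at hx
  have e1 : ((n : ℝ) + 2 * lam) * (∫ x in (-1 : ℝ)..1, (ultraPoly lam n).eval x * (1 - x ^ 2) ^ β)
      - ((n : ℝ) + 2 * β + 3) *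
        ∫ x in (-1 : ℝ)..1, x * (ultraPoly lam (n + 1)).eval x * (1 - x ^ 2) ^ β = 0 := by
    rw [← intervalIntegral.integral_const_mul, ← intervalIntegral.integral_const_mul,
      ← intervalIntegral.integral_sub (h0.const_mul _) (hx.const_mul _),
      ← integral_by_parts hβ (ultraPoly lam (n + 1))]
    congr 1
    ext x
    linear_combination - (1 - x ^ 2) ^ β * one_sub_sq_mul_derivative_succ lam n x
  have e2 : ((n : ℝ) + 2 * lam - 2 * β - 1) *
        (∫ x in (-1 : ℝ)..1, x * (ultraPoly lam (n + 1)).eval x * (1 - x ^ 2) ^ β)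
      - ((n : ℝ) + 2) *
        (∫ x in (-1 : ℝ)..1, (ultraPoly lam (n + 2)).eval x * (1 - x ^ 2) ^ β) = 0 := by
    rw [← intervalIntegral.integral_const_mul, ← intervalIntegral.integral_const_mul,
      ← intervalIntegral.integral_sub (hx.const_mul _) (h2.const_mul _),
      ← integral_by_parts hβ (ultraPoly lam (n + 1))]
    congr 1
    ext x
    have h := one_sub_sq_mul_derivative lam (n + 1) x
    push_cast at h
    linear_combination - (1 - x ^ 2) ^ β * h
  linear_combination (-(n : ℝ) - 2 * β - 3) * e2 - ((n : ℝ) + 2 * lam - 2 * β - 1) * e1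

theorem integral_ultraPoly_one (lam : ℝ) {β : ℝ} (hβ : -1 < β) :
    ∫ x in (-1 : ℝ)..1, (ultraPoly lam 1).eval x * (1 - x ^ 2) ^ β = 0 := by
  have h := integral_by_parts hβ 1
  have hc : β + 1 ≠ 0 := by linarith
  have : ∀ x : ℝ, (ultraPoly lam 1).eval x * (1 - x ^ 2) ^ β = (2 * lam / (-2 * (β + 1))) *
      (((1 - x ^ 2) * (Polynomial.derivative (1 : ℝ[X])).eval x
        - 2 * (β + 1) * x * (1 : ℝ[X]).eval x) * (1 - x ^ 2) ^ β) := by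
    intro x
    simp [ultraPoly]
    field_simp
  simp_rw [this]
  rw [intervalIntegral.integral_const_mul, h, mul_zero]

/-! ### The ultraspherical measure -/

theorem integrable_ultraMeasure_iff {lam : ℝ} {f : ℝ → ℝ} :
    Integrable f (ultraMeasure lam) ↔
      IntervalIntegrable (fun x => f x * (1 - x ^ 2) ^ (lam - 1 / 2)) volume (-1) 1 := by
  rw [ultraMeasure, integrable_withDensity_iff (by fun_prop) (by simp),
    intervalIntegrable_iff_integrableOn_Ioo_of_le (by norm_num), IntegrableOn]
  refine integrable_congr ?_
  filter_upwards [ae_restrict_mem measurableSet_Ioo] with x hx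
  rw [ENNReal.toReal_ofReal (Real.rpow_nonneg (by nlinarith [hx.1, hx.2]) _)]

theorem integral_ultraMeasure (lam : ℝ) (f : ℝ → ℝ) :
    ∫ x, f x ∂(ultraMeasure lam) =
      ∫ x in (-1 : ℝ)..1, f x * (1 - x ^ 2) ^ (lam - 1 / 2) := by
  rw [ultraMeasure, integral_withDensity_eq_integral_toReal_smul (by fun_prop) (by simp),
    intervalIntegral.integral_of_le (by norm_num), integral_Ioc_eq_integral_Ioo]
  refine integral_congr_ae ?_
  filter_upwards [ae_restrict_mem measurableSet_Ioo] with x hx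
  rw [ENNReal.toReal_ofReal (Real.rpow_nonneg (by nlinarith [hx.1, hx.2]) _), smul_eq_mul, mul_comm]

theorem ae_mem_Ioo (lam : ℝ) : ∀ᵐ x ∂(ultraMeasure lam), x ∈ Set.Ioo (-1 : ℝ) 1 :=
  (withDensity_absolutelyContinuous _ _).ae_le (ae_restrict_mem measurableSet_Ioo)

theorem integrable_mul_one_sub_sq_rpow {lam b : ℝ} (hb : -1 < lam - 1 / 2 + b) {g : ℝ → ℝ}
    (hg : ContinuousOn g (Set.Icc (-1) 1)) :
    Integrable (fun x => g x * (1 - x ^ 2) ^ b) (ultraMeasure lam) := by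
  rw [integrable_ultraMeasure_iff]
  have h := (intervalIntegrable_one_sub_sq_rpow hb).continuousOn_mul
    (g := g) (by rwa [Set.uIcc_of_le (by norm_num)])
  rw [intervalIntegrable_iff_integrableOn_Ioo_of_le (by norm_num)] at h ⊢
  refine h.congr ?_
  filter_upwards [ae_restrict_mem measurableSet_Ioo] with x hx
  rw [add_comm, Real.rpow_add (by nlinarith [hx.1, hx.2]), mul_assoc]

theorem integral_mul_one_sub_sq_rpow (lam b : ℝ) (g : ℝ → ℝ) :
    ∫ x, g x * (1 - x ^ 2) ^ b ∂(ultraMeasure lam) =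
      ∫ x in (-1 : ℝ)..1, g x * (1 - x ^ 2) ^ (lam - 1 / 2 + b) := by
  rw [integral_ultraMeasure, intervalIntegral.integral_of_le (by norm_num),
    intervalIntegral.integral_of_le (by norm_num), integral_Ioc_eq_integral_Ioo,
    integral_Ioc_eq_integral_Ioo]
  refine setIntegral_congr_fun measurableSet_Ioo fun x hx => ?_
  rw [add_comm, Real.rpow_add (by nlinarith [hx.1, hx.2]), mul_assoc]

theorem integrable_of_continuousOn {lam : ℝ} (hlam : 0 < lam) {g : ℝ → ℝ}
    (hg : ContinuousOn g (Set.Icc (-1) 1)) : Integrable g (ultraMeasure lam) := by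
  simpa using integrable_mul_one_sub_sq_rpow (b := 0) (by linarith) hg

theorem isFiniteMeasure_ultraMeasure {lam : ℝ} (hlam : 0 < lam) :
    IsFiniteMeasure (ultraMeasure lam) :=
  (integrable_const_iff_isFiniteMeasure (one_ne_zero (α := ℝ))).1
    (integrable_of_continuousOn hlam continuousOn_const)

theorem memLp_of_continuousOn {lam : ℝ} (hlam : 0 < lam) {g : ℝ → ℝ}
    (hg : ContinuousOn g (Set.Icc (-1) 1)) : MemLp g 2 (ultraMeasure lam) :=
  (memLp_two_iff_integrable_sq (integrable_of_continuousOn hlam hg).aestronglyMeasurable).2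
    (integrable_of_continuousOn hlam (hg.pow 2))

/-- Polynomials are dense in `L²` of the ultraspherical measure. -/
theorem exists_polynomial_eLpNorm_sub_le {lam : ℝ} (hlam : 0 < lam) {f : ℝ → ℝ}
    (hf : MemLp f 2 (ultraMeasure lam)) {ε : ENNReal} (hε : ε ≠ 0) :
    ∃ p : ℝ[X], eLpNorm (fun x => f x - p.eval x) 2 (ultraMeasure lam) ≤ ε := by
  have := isFiniteMeasure_ultraMeasure hlam
  have hε2 : ε / 2 ≠ 0 := by simpa using hε
  obtain ⟨g, -, hfg, hg, hgm⟩ := hf.exists_hasCompactSupport_eLpNorm_sub_le (by simp) hε2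
  obtain ⟨δ, hδ, hδε⟩ : ∃ δ : ℝ, 0 < δ ∧
      (ultraMeasure lam) Set.univ ^ (2 : ENNReal).toReal⁻¹ * ENNReal.ofReal δ ≤ ε / 2 := by
    have ht : Tendsto (fun δ : ℝ =>
        (ultraMeasure lam) Set.univ ^ (2 : ENNReal).toReal⁻¹ * ENNReal.ofReal δ) (𝓝[>] 0)
        (𝓝 ((ultraMeasure lam) Set.univ ^ (2 : ENNReal).toReal⁻¹ * ENNReal.ofReal 0)) := by
      refine ENNReal.Tendsto.const_mul ?_ (Or.inr ?_)
      · exact (ENNReal.continuous_ofReal.tendsto 0).mono_left nhdsWithin_le_nhds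
      · exact ENNReal.rpow_ne_top_of_nonneg (by simp) (measure_ne_top _ _)
    rw [ENNReal.ofReal_zero, mul_zero] at ht
    obtain ⟨δ, h1, h2⟩ := ((ht.eventually_le_const (pos_iff_ne_zero.2 hε2)).and
      self_mem_nhdsWithin).exists
    exact ⟨δ, h2, h1⟩
  obtain ⟨p, hp⟩ := exists_polynomial_near_of_continuousOn (-1) 1 g hg.continuousOn δ hδ
  have hgp : eLpNorm (fun x => g x - p.eval x) 2 (ultraMeasure lam) ≤ ε / 2 := by
    refine (eLpNorm_le_of_ae_bound (C := δ) ?_).trans hδε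
    filter_upwards [ae_mem_Ioo lam] with x hx
    rw [Real.norm_eq_abs, abs_sub_comm]
    exact (hp x ⟨hx.1.le, hx.2.le⟩).le
  have hpm := memLp_of_continuousOn hlam p.continuous.continuousOn
  refine ⟨p, ?_⟩
  calc eLpNorm (fun x => f x - p.eval x) 2 (ultraMeasure lam)
      = eLpNorm ((f - g) + fun x => g x - p.eval x) 2 (ultraMeasure lam) := by
        congr 1; ext x; simp
    _ ≤ _ := eLpNorm_add_le (hf.sub hgm).1 (hgm.sub hpm).1 (by norm_num)
    _ ≤ ε / 2 + ε / 2 := add_le_add hfg hgp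
    _ = ε := ENNReal.add_halves ε

/-! ### Orthogonality -/

theorem integral_ultraPoly_mul_ultraPoly {lam : ℝ} (hlam : 0 < lam) {n m : ℕ} (hnm : n ≠ m) :
    ∫ x, (ultraPoly lam n).eval x * (ultraPoly lam m).eval x ∂(ultraMeasure lam) = 0 := by
  have hne : (n : ℝ) * (n + 2 * lam) - m * (m + 2 * lam) ≠ 0 := by
    have h1 : (n : ℝ) - m ≠ 0 := sub_ne_zero.2 (by exact_mod_cast hnm)
    have h2 : (n : ℝ) + m + 2 * lam ≠ 0 := by positivity
    convert! mul_ne_zero h1 h2 using 1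
    ring
  -- the Wronskian turns the difference of the two differential equations into a divergence
  have h := integral_by_parts (β := lam - 1 / 2) (by linarith)
    (ultraPoly lam n * (ultraPoly lam m).derivative
      - ultraPoly lam m * (ultraPoly lam n).derivative)
  rw [integral_ultraMeasure]
  apply mul_left_cancel₀ hne
  rw [mul_zero, ← intervalIntegral.integral_const_mul, ← h]
  congr 1
  ext x
  have hn := differential_equation lam n x
  have hm := differential_equation lam m x
  simp only [Polynomial.derivative_sub, Polynomial.derivative_mul, Polynomial.eval_sub,
    Polynomial.eval_add, Polynomial.eval_mul]
  linear_combination (1 - x ^ 2) ^ (lam - 1 / 2) *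
    ((ultraPoly lam m).eval x * hn - (ultraPoly lam n).eval x * hm)

theorem integral_eval_sq_pos {lam : ℝ} (hlam : 0 < lam) {p : ℝ[X]} (hp : p ≠ 0) :
    0 < ∫ x, p.eval x ^ 2 ∂(ultraMeasure lam) := by
  refine (integral_nonneg fun x => sq_nonneg _).lt_of_ne' fun h0 => ?_
  have hint : IntegrableOn (fun x : ℝ => p.eval x ^ 2 * (1 - x ^ 2) ^ (lam - 1 / 2))
      (Set.Ioo (-1) 1) := by
    rw [← intervalIntegrable_iff_integrableOn_Ioo_of_le (by norm_num),
      ← integrable_ultraMeasure_iff]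
    exact integrable_of_continuousOn hlam (by fun_prop)
  rw [integral_ultraMeasure, intervalIntegral.integral_of_le (by norm_num),
    integral_Ioc_eq_integral_Ioo, integral_eq_zero_iff_of_nonneg_ae ?_ hint] at h0
  · rw [EventuallyEq, ae_restrict_iff' measurableSet_Ioo] at h0
    have hroots : ∀ᵐ x : ℝ, x ∉ (p.roots.toFinset : Set ℝ) :=
      (measure_eq_zero_iff_ae_notMem.1 (p.roots.toFinset.finite_toSet.measure_zero volume))
    have : volume (Set.Ioo (-1 : ℝ) 1) = 0 := by
      rw [measure_eq_zero_iff_ae_notMem]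
      filter_upwards [h0, hroots] with x hx hr hmem
      have hpos : 0 < (1 - x ^ 2) ^ (lam - 1 / 2) :=
        Real.rpow_pos_of_pos (by nlinarith [hmem.1, hmem.2]) _
      have hroot := pow_eq_zero_iff two_ne_zero |>.1
        ((mul_eq_zero.1 (hx hmem)).resolve_right hpos.ne')
      exact hr (by simpa [hp] using hroot)
    norm_num at this
  · filter_upwards [ae_restrict_mem measurableSet_Ioo] with x hx
    exact mul_nonneg (sq_nonneg _) (Real.rpow_nonneg (by nlinarith [hx.1, hx.2]) _)

theorem ultraPolyNorm_pos {lam : ℝ} (hlam : 0 < lam) (n : ℕ) : 0 < ultraPolyNorm lam n :=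
  Real.sqrt_pos.2 (integral_eval_sq_pos hlam (ultraPoly_ne_zero hlam n))

theorem continuous_ultraBasis (lam : ℝ) (n : ℕ) : Continuous (ultraBasis lam n) := by
  unfold ultraBasis
  fun_prop

theorem ultraCoeff_ultraBasis {lam : ℝ} (hlam : 0 < lam) (n m : ℕ) :
    ultraCoeff lam (ultraBasis lam n) m = if n = m then 1 else 0 := by
  have h : ∀ x, ultraBasis lam n x * ultraBasis lam m x =
      (ultraPolyNorm lam n * ultraPolyNorm lam m)⁻¹ *
        ((ultraPoly lam n).eval x * (ultraPoly lam m).eval x) := by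
    intro x
    simp only [ultraBasis]
    field_simp
  simp only [ultraCoeff, ultraInner, h]
  rw [integral_const_mul]
  split_ifs with hnm
  · subst hnm
    have h2 : ultraPolyNorm lam n * ultraPolyNorm lam n =
        ∫ x, (ultraPoly lam n).eval x * (ultraPoly lam n).eval x ∂(ultraMeasure lam) := by
      rw [ultraPolyNorm, Real.mul_self_sqrt (integral_nonneg fun x => sq_nonneg _)]
      simp only [sq]
    rw [← h2]
    exact inv_mul_cancel₀ (mul_self_ne_zero.2 (ultraPolyNorm_pos hlam n).ne')
  · rw [integral_ultraPoly_mul_ultraPoly hlam hnm, mul_zero]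

theorem ultraInner_sum {lam : ℝ} {f : ℝ → ℝ}
    (hf : ∀ n, Integrable (fun x => f x * ultraBasis lam n x) (ultraMeasure lam))
    (N : ℕ) (k : ℕ → ℝ) :
    ultraInner lam f (fun x => ∑ n ∈ Finset.range N, k n * ultraBasis lam n x) =
      ∑ n ∈ Finset.range N, k n * ultraCoeff lam f n := by
  simp only [ultraInner, ultraCoeff, Finset.mul_sum]
  rw [integral_finsetSum _ fun n _ => by
    simpa only [mul_left_comm] using (hf n).const_mul (k n)]
  refine Finset.sum_congr rfl fun n _ => ?_
  rw [← integral_const_mul]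
  simp only [mul_left_comm]

/-- The orthogonal expansion of a polynomial is finite. -/
theorem exists_expansion {lam : ℝ} (hlam : 0 < lam) (p : ℝ[X]) :
    ∃ N₀ : ℕ, ∀ N, N₀ ≤ N → ∀ x,
      p.eval x = ∑ n ∈ Finset.range N, ultraCoeff lam (fun y => p.eval y) n * ultraBasis lam n x := by
  obtain ⟨N₀, b, hb⟩ := exists_eq_sum_ultraPoly hlam p
  have hp : ∀ x, p.eval x =
      ∑ n ∈ Finset.range N₀, (b n * ultraPolyNorm lam n) * ultraBasis lam n x := by
    intro x
    conv_lhs => rw [hb, Polynomial.eval_finsetSum]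
    refine Finset.sum_congr rfl fun n _ => ?_
    have := (ultraPolyNorm_pos hlam n).ne'
    simp [ultraBasis]
    field_simp
  have hcoeff : ∀ m, ultraCoeff lam (fun y => p.eval y) m =
      if m < N₀ then b m * ultraPolyNorm lam m else 0 := by
    intro m
    have h := ultraInner_sum (lam := lam) (f := ultraBasis lam m)
      (fun n => integrable_of_continuousOn hlam
        ((continuous_ultraBasis lam m).mul (continuous_ultraBasis lam n)).continuousOn)
      N₀ (fun n => b n * ultraPolyNorm lam n)
    simp only [← hp] at h
    rw [ultraCoeff, ultraInner]
    rw [ultraInner] at h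
    simp only [mul_comm (ultraBasis lam m _)] at h
    rw [h]
    simp [ultraCoeff_ultraBasis hlam]
  refine ⟨N₀, fun N hN x => ?_⟩
  rw [hp, ← Finset.sum_subset (Finset.range_mono hN)]
  · refine Finset.sum_congr rfl fun n hn => ?_
    rw [hcoeff, if_pos (Finset.mem_range.1 hn)]
  · intro n _ hn
    rw [hcoeff, if_neg (by simpa using hn), zero_mul]

/-! ### Positivity of the Poisson semigroup -/

theorem deriv_deriv_nonneg_of_isLocalMin {f : ℝ → ℝ} {x : ℝ} (h : IsLocalMin f x)
    (hc : ContinuousAt f x) : 0 ≤ deriv (deriv f) x := by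
  by_contra! hneg
  -- otherwise `x` is also a local maximum, so that `f` is constant near `x`
  have hmax := isLocalMax_of_deriv_deriv_neg hneg h.deriv_eq_zero hc
  have hconst : f =ᶠ[𝓝 x] fun _ => f x := by
    filter_upwards [h, hmax] with y h1 h2 using le_antisymm h2 h1
  have := hconst.deriv.deriv_eq
  simp at this
  exact hneg.ne this

theorem eval_second_derivative_nonneg {p : ℝ[X]} {x : ℝ} (h : IsLocalMin (fun y => p.eval y) x) :
    p.derivative.eval x = 0 ∧ 0 ≤ p.derivative.derivative.eval x := by
  have h1 : deriv (fun y => p.eval y) = fun y => p.derivative.eval y := by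
    ext y; simp
  have h2 := deriv_deriv_nonneg_of_isLocalMin h p.continuous.continuousAt
  have h3 := h.deriv_eq_zero
  rw [h1] at h2 h3
  exact ⟨h3, by simpa using h2⟩

/-- The ultraspherical operator is nonnegative at a minimum over `[-1, 1]`, also when the minimum
is attained at an end point. -/
theorem operator_nonneg_of_isMinOn {lam : ℝ} (hlam : 0 < lam) {p : ℝ[X]} {x : ℝ}
    (hx : x ∈ Set.Icc (-1 : ℝ) 1) (h : IsMinOn (fun y => p.eval y) (Set.Icc (-1) 1) x) :
    0 ≤ (1 - x ^ 2) * p.derivative.derivative.eval x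
      - (2 * lam + 1) * x * p.derivative.eval x := by
  rcases eq_or_lt_of_le hx.1 with rfl | h1
  · have : 0 ≤ p.derivative.eval (-1) := by
      have hd : HasDerivWithinAt (fun y => p.eval y) (p.derivative.eval (-1)) (Set.Ici (-1)) (-1) :=
        (p.hasDerivAt (-1)).hasDerivWithinAt
      refine ge_of_tendsto ((hasDerivWithinAt_iff_tendsto_slope' (by simp)).1 hd.Ioi_of_Ici) ?_
      filter_upwards [Ioc_mem_nhdsGT (show (-1 : ℝ) < 1 by norm_num)] with y hy
      rw [slope_def_field]
      exact div_nonneg (sub_nonneg.2 (h ⟨hy.1.le, hy.2⟩)) (by linarith [hy.1])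
    nlinarith
  rcases eq_or_lt_of_le hx.2 with rfl | h2
  · have : p.derivative.eval 1 ≤ 0 := by
      have hd : HasDerivWithinAt (fun y => p.eval y) (p.derivative.eval 1) (Set.Iio 1) 1 :=
        (p.hasDerivAt 1).hasDerivWithinAt
      refine le_of_tendsto ((hasDerivWithinAt_iff_tendsto_slope' (by simp)).1 hd) ?_
      filter_upwards [Ico_mem_nhdsLT (show (-1 : ℝ) < 1 by norm_num)] with y hy
      rw [slope_def_field]
      exact div_nonpos_of_nonneg_of_nonpos (sub_nonneg.2 (h ⟨hy.1, hy.2.le⟩)) (by linarith [hy.2])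
    nlinarith
  · obtain ⟨e1, e2⟩ := eval_second_derivative_nonneg (h.isLocalMin (Icc_mem_nhds h1 h2))
    rw [e1, mul_zero, sub_zero]
    exact mul_nonneg (by nlinarith) e2

/-- The Poisson semigroup of the ultraspherical expansion is positive: the Poisson extension
`u (r, x) = ∑ b_n r ^ n C_n x` solves `r² u_rr + (2λ + 1) r u_r + (1 - x²) u_xx - (2λ + 1) x u_x = 0`
and is nonnegative for `r = 0` (its value is the mean) and for `r = 1`, so the maximum principle
applies. -/
theorem poisson_nonneg {lam : ℝ} (hlam : 0 < lam) (N : ℕ) (b : ℕ → ℝ)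
    (hb : ∀ x ∈ Set.Icc (-1 : ℝ) 1, 0 ≤ ∑ n ∈ Finset.range N, b n * (ultraPoly lam n).eval x)
    {r x : ℝ} (hr : r ∈ Set.Icc (0 : ℝ) 1) (hx : x ∈ Set.Icc (-1 : ℝ) 1) :
    0 ≤ ∑ n ∈ Finset.range N, b n * r ^ n * (ultraPoly lam n).eval x := by
  rcases N.eq_zero_or_pos with rfl | hN
  · simp
  have hb0 : 0 ≤ b 0 := by
    have h1 : 0 ≤ ∫ x, ∑ n ∈ Finset.range N, b n * (ultraPoly lam n).eval x ∂(ultraMeasure lam) :=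
      integral_nonneg_of_ae ((ae_mem_Ioo lam).mono fun x hx => hb x ⟨hx.1.le, hx.2.le⟩)
    rw [integral_finsetSum _ fun n _ => integrable_of_continuousOn hlam (by fun_prop),
      Finset.sum_eq_single_of_mem 0 (Finset.mem_range.2 hN)] at h1
    · rw [integral_const_mul] at h1
      have h2 := integral_eval_sq_pos hlam (ultraPoly_ne_zero hlam 0)
      simp only [ultraPoly, Polynomial.eval_one, one_pow] at h1 h2
      exact nonneg_of_mul_nonneg_left h1 h2
    · intro n _ hn
      have := integral_ultraPoly_mul_ultraPoly hlam hn
      simp only [ultraPoly, Polynomial.eval_one, mul_one] at this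
      rw [integral_const_mul, this, mul_zero]
  set u : ℝ × ℝ → ℝ := fun z => ∑ n ∈ Finset.range N, b n * z.1 ^ n * (ultraPoly lam n).eval z.2
    with hu
  have huc : Continuous u := by fun_prop
  suffices H : ∀ ε > 0, 0 ≤ u (r, x) + ε * (1 - r ^ 2) by
    refine le_of_forall_pos_le_add fun ε hε => (H ε hε).trans ?_
    have : ε * (1 - r ^ 2) ≤ ε := by nlinarith [sq_nonneg r]
    change u (r, x) + _ ≤ u (r, x) + _
    linarith
  intro ε hε
  set v : ℝ × ℝ → ℝ := fun z => u z + ε * (1 - z.1 ^ 2) with hv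
  have hvc : Continuous v := by fun_prop
  obtain ⟨⟨s, y⟩, hmem, hmin⟩ := (isCompact_Icc.prod isCompact_Icc :
    IsCompact (Set.Icc (0 : ℝ) 1 ×ˢ Set.Icc (-1 : ℝ) 1)).exists_isMinOn
      ⟨(0, 0), by simp⟩ hvc.continuousOn
  obtain ⟨hs, hy⟩ := Set.mem_prod.1 hmem
  simp only at hs hy
  refine le_trans ?_ (hmin (Set.mk_mem_prod hr hx))
  rcases eq_or_lt_of_le hs.1 with rfl | hs0
  · have : u (0, y) = b 0 := by
      simp only [hu]
      rw [Finset.sum_eq_single_of_mem 0 (Finset.mem_range.2 hN)]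
      · simp [ultraPoly]
      · intro n _ hn
        simp [hn]
    simp only [hv, this]
    nlinarith
  rcases eq_or_lt_of_le hs.2 with rfl | hs1
  · have := hb y hy
    simpa [hv, hu] using this
  exfalso
  -- the two one-variable slices through an interior minimum
  set P : ℝ[X] := ∑ n ∈ Finset.range N, Polynomial.C (b n * s ^ n) * ultraPoly lam n with hP
  set R : ℝ[X] := (∑ n ∈ Finset.range N,
    Polynomial.C (b n * (ultraPoly lam n).eval y) * Polynomial.X ^ n)
      + Polynomial.C ε * (1 - Polynomial.X ^ 2) with hR
  have hPv : ∀ t, P.eval t = v (s, t) - ε * (1 - s ^ 2) := by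
    intro t
    simp [hP, hv, hu, Polynomial.eval_finsetSum]
  have hRv : ∀ t, R.eval t = v (t, y) := by
    intro t
    simp only [hR, hv, hu, Polynomial.eval_add, Polynomial.eval_finsetSum, Polynomial.eval_mul,
      Polynomial.eval_C, Polynomial.eval_pow, Polynomial.eval_X, Polynomial.eval_sub,
      Polynomial.eval_one]
    congr 1
    exact Finset.sum_congr rfl fun n _ => by ring
  have hP0 := operator_nonneg_of_isMinOn hlam (p := P) hy fun t ht => by
    simpa [hPv] using hmin (Set.mk_mem_prod hs ht)
  obtain ⟨hR1, hR2⟩ := eval_second_derivative_nonneg (p := R) (x := s) (by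
    filter_upwards [Icc_mem_nhds hs0 hs1] with t ht
    simpa [hRv] using hmin (Set.mk_mem_prod ht hy))
  have hdR : s * R.derivative.eval s = (∑ n ∈ Finset.range N,
      n * (b n * s ^ n * (ultraPoly lam n).eval y)) - 2 * ε * s ^ 2 := by
    simp only [hR, Polynomial.derivative_add, Polynomial.derivative_sum, Polynomial.eval_add,
      Polynomial.eval_finsetSum, mul_add, Finset.mul_sum]
    rw [sub_eq_add_neg]
    congr 1
    · refine Finset.sum_congr rfl fun n _ => ?_
      cases n with
      | zero => simp
      | succ n => simp; ring
    · simp; ring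
  have hddR : s ^ 2 * R.derivative.derivative.eval s = (∑ n ∈ Finset.range N,
      n * (n - 1) * (b n * s ^ n * (ultraPoly lam n).eval y)) - 2 * ε * s ^ 2 := by
    simp only [hR, Polynomial.derivative_add, Polynomial.derivative_sum, Polynomial.eval_add,
      Polynomial.eval_finsetSum, mul_add, Finset.mul_sum]
    rw [sub_eq_add_neg]
    congr 1
    · refine Finset.sum_congr rfl fun n _ => ?_
      rcases n with _ | _ | n
      · simp
      · simp
      · simp; ring
    · simp; ring
  have hPP : (1 - y ^ 2) * P.derivative.derivative.eval y
      - (2 * lam + 1) * y * P.derivative.eval y = - ∑ n ∈ Finset.range N,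
        (n * (n - 1) + (2 * lam + 1) * n) * (b n * s ^ n * (ultraPoly lam n).eval y) := by
    simp only [hP, Polynomial.derivative_sum, Polynomial.eval_finsetSum, Finset.mul_sum]
    rw [← Finset.sum_sub_distrib, ← Finset.sum_neg_distrib]
    refine Finset.sum_congr rfl fun n _ => ?_
    have := differential_equation lam n y
    simp only [Polynomial.derivative_C_mul, Polynomial.eval_C_mul]
    linear_combination b n * s ^ n * this
  have hsum : ∑ n ∈ Finset.range N, ((n : ℝ) * (n - 1) + (2 * lam + 1) * n) *
        (b n * s ^ n * (ultraPoly lam n).eval y) =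
      (∑ n ∈ Finset.range N, (n : ℝ) * (n - 1) * (b n * s ^ n * (ultraPoly lam n).eval y)) +
      (2 * lam + 1) * ∑ n ∈ Finset.range N, (n : ℝ) * (b n * s ^ n * (ultraPoly lam n).eval y) := by
    rw [Finset.mul_sum, ← Finset.sum_add_distrib]
    exact Finset.sum_congr rfl fun n _ => by ring
  rw [hPP, hsum] at hP0
  rw [hR1, mul_zero] at hdR
  have h1 : 0 ≤ s ^ 2 * R.derivative.derivative.eval s := by positivity
  have h2 : 0 < ε * s ^ 2 := by positivity
  nlinarith

/-! ### The multiplier -/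

theorem ultraMultiplier_pos {lam σ : ℝ} (hlam : 0 < lam) (hσ0 : 0 < σ) (hσ1 : σ < 1) (n : ℕ) :
    0 < ultraMultiplier lam σ n :=
  div_pos (Real.Gamma_pos_of_pos (by positivity))
    (Real.Gamma_pos_of_pos (by have : (0 : ℝ) ≤ n := n.cast_nonneg; linarith))

/-- The upper bound `Γ (y + σ) / Γ y ≤ y ^ σ` comes from the log-convexity of `Γ`. -/
theorem ultraMultiplier_le {lam σ : ℝ} (hlam : 0 < lam) (hσ0 : 0 < σ) (hσ1 : σ < 1) (n : ℕ) :
    ultraMultiplier lam σ n ≤ (1 + 1 / lam) ^ σ * ((n : ℝ) + lam) ^ σ := by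
  have hn : (0 : ℝ) ≤ n := n.cast_nonneg
  set y : ℝ := (n : ℝ) + lam + (1 - σ) / 2 with hy
  have hy0 : 0 < y := by linarith
  have hG := Real.Gamma_pos_of_pos hy0
  have h := Real.Gamma_mul_add_mul_le_rpow_Gamma_mul_rpow_Gamma hy0 (by linarith : 0 < y + 1)
    (by linarith : 0 < 1 - σ) hσ0 (by ring)
  rw [Real.Gamma_add_one hy0.ne', Real.mul_rpow hy0.le hG.le, mul_left_comm,
    ← Real.rpow_add hG, sub_add_cancel, Real.rpow_one,
    show (1 - σ) * y + σ * (y + 1) = (n : ℝ) + lam + (1 + σ) / 2 by rw [hy]; ring] at h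
  rw [ultraMultiplier, div_le_iff₀ hG, ← Real.mul_rpow (by positivity) (by positivity)]
  refine h.trans ?_
  gcongr
  have : (1 + 1 / lam) * (n + lam) = n + lam + 1 + n / lam := by field_simp; ring
  rw [this, hy]
  have : 0 ≤ n / lam := by positivity
  linarith

theorem ultraMultiplier_add_two {lam σ : ℝ} (hlam : 0 < lam) (hσ0 : 0 < σ) (hσ1 : σ < 1) (n : ℕ) :
    ((n : ℝ) + lam + (1 - σ) / 2) * ((n : ℝ) + lam + (1 - σ) / 2 + 1)
        * ultraMultiplier lam σ (n + 2) =
      ((n : ℝ) + lam + (1 + σ) / 2) * ((n : ℝ) + lam + (1 + σ) / 2 + 1)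
        * ultraMultiplier lam σ n := by
  have hn : (0 : ℝ) ≤ n := n.cast_nonneg
  have key : ∀ y : ℝ, 0 < y → Real.Gamma (y + 1 + 1) = y * (y + 1) * Real.Gamma y := by
    intro y hy
    rw [Real.Gamma_add_one (by positivity), Real.Gamma_add_one hy.ne']
    ring
  have h1 : 0 < (n : ℝ) + lam + (1 - σ) / 2 := by linarith
  have h2 : 0 < (n : ℝ) + lam + (1 + σ) / 2 := by linarith
  have hG := (Real.Gamma_pos_of_pos h1).ne'
  rw [ultraMultiplier, ultraMultiplier,
    show ((n + 2 : ℕ) : ℝ) + lam + (1 + σ) / 2 = (n : ℝ) + lam + (1 + σ) / 2 + 1 + 1 by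
      push_cast; ring,
    show ((n + 2 : ℕ) : ℝ) + lam + (1 - σ) / 2 = (n : ℝ) + lam + (1 - σ) / 2 + 1 + 1 by
      push_cast; ring, key _ h1, key _ h2]
  generalize (n : ℝ) + lam + (1 - σ) / 2 = y at *
  generalize (n : ℝ) + lam + (1 + σ) / 2 = z at *
  field_simp

/-- The inverse of `A_σ^λ` is positivity preserving, being an average of the Poisson semigroup:
`m_n⁻¹ = Γ(σ)⁻¹ ∫₀¹ r ^ n r ^ (λ + (1 - σ) / 2 - 1) (1 - r) ^ (σ - 1) dr`. -/
theorem inverse_nonneg {lam σ : ℝ} (hlam : 0 < lam) (hσ0 : 0 < σ) (hσ1 : σ < 1) (N : ℕ)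
    (b : ℕ → ℝ)
    (hb : ∀ x ∈ Set.Icc (-1 : ℝ) 1, 0 ≤ ∑ n ∈ Finset.range N, b n * (ultraPoly lam n).eval x)
    {x : ℝ} (hx : x ∈ Set.Icc (-1 : ℝ) 1) :
    0 ≤ ∑ n ∈ Finset.range N, b n / ultraMultiplier lam σ n * (ultraPoly lam n).eval x := by
  have hbeta : ∀ n : ℕ, IntervalIntegrable (fun r : ℝ =>
      r ^ (((n : ℝ) + lam + (1 - σ) / 2) - 1) * (1 - r) ^ (σ - 1)) volume 0 1 := fun n =>
    intervalIntegrable_beta (by have : (0 : ℝ) ≤ n := n.cast_nonneg; linarith) hσ0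
  have hm : ∀ n : ℕ, (ultraMultiplier lam σ n)⁻¹ = (Real.Gamma σ)⁻¹ *
      ∫ r in (0 : ℝ)..1, r ^ (((n : ℝ) + lam + (1 - σ) / 2) - 1) * (1 - r) ^ (σ - 1) := by
    intro n
    have hn : (0 : ℝ) ≤ n := n.cast_nonneg
    rw [integral_beta (by linarith) hσ0, ultraMultiplier]
    have := (Real.Gamma_pos_of_pos hσ0).ne'
    rw [show (n : ℝ) + lam + (1 - σ) / 2 + σ = n + lam + (1 + σ) / 2 by ring]
    field_simp
  have hsum : ∑ n ∈ Finset.range N, b n / ultraMultiplier lam σ n * (ultraPoly lam n).eval x =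
      (Real.Gamma σ)⁻¹ * ∫ r in (0 : ℝ)..1, ∑ n ∈ Finset.range N,
        (b n * (ultraPoly lam n).eval x) *
          (r ^ (((n : ℝ) + lam + (1 - σ) / 2) - 1) * (1 - r) ^ (σ - 1)) := by
    rw [intervalIntegral.integral_finsetSum fun n _ => (hbeta n).const_mul _, Finset.mul_sum]
    refine Finset.sum_congr rfl fun n _ => ?_
    rw [intervalIntegral.integral_const_mul, div_eq_mul_inv, hm]
    ring
  rw [hsum]
  refine mul_nonneg (inv_nonneg.2 (Real.Gamma_pos_of_pos hσ0).le) ?_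
  rw [intervalIntegral.integral_of_le zero_le_one, integral_Ioc_eq_integral_Ioo]
  refine setIntegral_nonneg measurableSet_Ioo fun r hr => ?_
  have h := poisson_nonneg hlam N b hb ⟨hr.1.le, hr.2.le⟩ hx
  have h1r : 0 ≤ 1 - r := by linarith [hr.2]
  have : ∑ n ∈ Finset.range N, (b n * (ultraPoly lam n).eval x) *
        (r ^ (((n : ℝ) + lam + (1 - σ) / 2) - 1) * (1 - r) ^ (σ - 1)) =
      (∑ n ∈ Finset.range N, b n * r ^ n * (ultraPoly lam n).eval x) *
        (r ^ (lam + (1 - σ) / 2 - 1) * (1 - r) ^ (σ - 1)) := by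
    rw [Finset.sum_mul]
    refine Finset.sum_congr rfl fun n _ => ?_
    rw [show (n : ℝ) + lam + (1 - σ) / 2 - 1 = n + (lam + (1 - σ) / 2 - 1) by ring,
      Real.rpow_add hr.1, Real.rpow_natCast]
    ring
  rw [this]
  exact mul_nonneg h (mul_nonneg (Real.rpow_nonneg hr.1.le _) (Real.rpow_nonneg h1r _))

/-! ### The ground state -/

theorem ultraHardyConst_pos {lam σ : ℝ} (hlam : 0 < lam) (hσ0 : 0 < σ) (hσ1 : σ < 1) :
    0 < ultraHardyConst lam σ := by
  have h1 := Real.Gamma_pos_of_pos (by linarith : 0 < lam / 2 + (1 + σ) / 4)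
  have h2 := Real.Gamma_pos_of_pos (by linarith : 0 < lam / 2 + (1 - σ) / 4)
  unfold ultraHardyConst
  positivity

theorem ultraHardyConst_mul_integral {lam σ : ℝ} (hlam : 0 < lam) (hσ0 : 0 < σ) (hσ1 : σ < 1) :
    ultraHardyConst lam σ * ∫ x in (-1 : ℝ)..1, (1 - x ^ 2) ^ (lam / 2 - 3 / 4 - σ / 4) =
      ultraMultiplier lam σ 0 * ∫ x in (-1 : ℝ)..1, (1 - x ^ 2) ^ (lam / 2 - 3 / 4 + σ / 4) := by
  rw [integral_one_sub_sq_rpow (by linarith), integral_one_sub_sq_rpow (by linarith),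
    ultraHardyConst, ultraMultiplier,
    show lam / 2 - 3 / 4 - σ / 4 + 1 = lam / 2 + (1 - σ) / 4 by ring,
    show lam / 2 - 3 / 4 + σ / 4 + 1 = lam / 2 + (1 + σ) / 4 by ring,
    show 2 * (lam / 2 - 3 / 4 - σ / 4) + 2 = lam + (1 - σ) / 2 by ring,
    show 2 * (lam / 2 - 3 / 4 + σ / 4) + 2 = lam + (1 + σ) / 2 by ring]
  have h1 := (Real.Gamma_pos_of_pos (by linarith : 0 < lam / 2 + (1 + σ) / 4)).ne'
  have h2 := (Real.Gamma_pos_of_pos (by linarith : 0 < lam / 2 + (1 - σ) / 4)).ne'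
  have h3 := (Real.Gamma_pos_of_pos (by linarith : 0 < lam + (1 + σ) / 2)).ne'
  have h4 := (Real.Gamma_pos_of_pos (by linarith : 0 < lam + (1 - σ) / 2)).ne'
  have hpow : (4 : ℝ) ^ (lam / 2 - 3 / 4 + σ / 4) = 2 ^ σ * 4 ^ (lam / 2 - 3 / 4 - σ / 4) := by
    rw [show (4 : ℝ) = 2 ^ (2 : ℝ) by norm_num, ← Real.rpow_mul (by norm_num),
      ← Real.rpow_mul (by norm_num), ← Real.rpow_add (by norm_num)]
    congr 1
    ring
  rw [hpow]
  simp only [Nat.cast_zero, zero_add]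
  generalize Real.Gamma (lam / 2 + (1 + σ) / 4) = G₁ at *
  generalize Real.Gamma (lam / 2 + (1 - σ) / 4) = G₂ at *
  generalize Real.Gamma (lam + (1 + σ) / 2) = G₃ at *
  generalize Real.Gamma (lam + (1 - σ) / 2) = G₄ at *
  field_simp

/-- The moments of the two powers of `1 - x²` in the ground state identity `A_σ^λ w = Q V w`. -/
theorem ultraHardyConst_mul_integral_ultraPoly {lam σ : ℝ} (hlam : 0 < lam) (hσ0 : 0 < σ)
    (hσ1 : σ < 1) (n : ℕ) :
    ultraHardyConst lam σ * ∫ x in (-1 : ℝ)..1,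
        (ultraPoly lam n).eval x * (1 - x ^ 2) ^ (lam / 2 - 3 / 4 - σ / 4) =
      ultraMultiplier lam σ n * ∫ x in (-1 : ℝ)..1,
        (ultraPoly lam n).eval x * (1 - x ^ 2) ^ (lam / 2 - 3 / 4 + σ / 4) := by
  induction n using Nat.twoStepInduction with
  | zero => simpa [ultraPoly] using ultraHardyConst_mul_integral hlam hσ0 hσ1
  | one => rw [integral_ultraPoly_one _ (by linarith), integral_ultraPoly_one _ (by linarith),
      mul_zero, mul_zero]
  | more n ih _ =>
    have hn : (0 : ℝ) ≤ n := n.cast_nonneg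
    have hh := integral_ultraPoly_succ_succ lam
      (by linarith : -1 < lam / 2 - 3 / 4 - σ / 4) n
    have hw := integral_ultraPoly_succ_succ lam
      (by linarith : -1 < lam / 2 - 3 / 4 + σ / 4) n
    have hm := ultraMultiplier_add_two hlam hσ0 hσ1 n
    set Ih2 := ∫ x in (-1 : ℝ)..1,
      (ultraPoly lam (n + 2)).eval x * (1 - x ^ 2) ^ (lam / 2 - 3 / 4 - σ / 4)
    set Iw2 := ∫ x in (-1 : ℝ)..1,
      (ultraPoly lam (n + 2)).eval x * (1 - x ^ 2) ^ (lam / 2 - 3 / 4 + σ / 4)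
    set Ih := ∫ x in (-1 : ℝ)..1,
      (ultraPoly lam n).eval x * (1 - x ^ 2) ^ (lam / 2 - 3 / 4 - σ / 4)
    set Iw := ∫ x in (-1 : ℝ)..1,
      (ultraPoly lam n).eval x * (1 - x ^ 2) ^ (lam / 2 - 3 / 4 + σ / 4)
    set a : ℝ := (n : ℝ) + lam + (1 - σ) / 2 with ha
    set c : ℝ := (n : ℝ) + lam + (1 + σ) / 2 with hc
    have ha0 : 0 < a := by linarith
    have hc0 : 0 < c := by linarith
    have hh' : ((n : ℝ) + 2) * (a + 1) * Ih2 = c * (n + 2 * lam) * Ih := by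
      rw [ha, hc]; linear_combination hh
    have hw' : ((n : ℝ) + 2) * (c + 1) * Iw2 = a * (n + 2 * lam) * Iw := by
      rw [ha, hc]; linear_combination hw
    have hne : ((n : ℝ) + 2) * (a + 1) * (a * (c + 1)) ≠ 0 := by positivity
    apply mul_left_cancel₀ hne
    linear_combination ultraHardyConst lam σ * a * (c + 1) * hh'
      + a * (c + 1) * c * (n + 2 * lam) * ih - (n + 2) * (c + 1) * Iw2 * hm
      - c * (c + 1) * ultraMultiplier lam σ n * hw'

/-- Coefficientwise form of the ground state identity `A_σ^λ w = Q V w` for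
`w = (1 - x²) ^ (-(2λ + 1 - σ) / 4)` and `V w = (1 - x²) ^ (-(2λ + 1 + σ) / 4)`. -/
theorem ultraCoeff_groundState {lam σ : ℝ} (hlam : 0 < lam) (hσ0 : 0 < σ)
    (hσ1 : σ < 1) (n : ℕ) :
    ultraHardyConst lam σ *
        ultraCoeff lam (fun x => (1 - x ^ 2) ^ (-(2 * lam + 1 + σ) / 4)) n =
      ultraMultiplier lam σ n *
        ultraCoeff lam (fun x => (1 - x ^ 2) ^ (-(2 * lam + 1 - σ) / 4)) n := by
  have key : ∀ b : ℝ, ultraCoeff lam (fun x => (1 - x ^ 2) ^ b) n =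
      (∫ x in (-1 : ℝ)..1, (ultraPoly lam n).eval x * (1 - x ^ 2) ^ (lam - 1 / 2 + b))
        / ultraPolyNorm lam n := by
    intro b
    rw [← integral_mul_one_sub_sq_rpow, ← integral_div]
    simp only [ultraCoeff, ultraInner, ultraBasis]
    congr 1
    ext x
    ring
  rw [key, key, show lam - 1 / 2 + -(2 * lam + 1 + σ) / 4 = lam / 2 - 3 / 4 - σ / 4 by ring,
    show lam - 1 / 2 + -(2 * lam + 1 - σ) / 4 = lam / 2 - 3 / 4 + σ / 4 by ring,
    mul_div_assoc', mul_div_assoc', ultraHardyConst_mul_integral_ultraPoly hlam hσ0 hσ1]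

/-! ### The dual inequality for polynomials -/

theorem ultraCoeff_combination {lam : ℝ} (hlam : 0 < lam) (p g q : ℝ[X]) (s t : ℝ) (n : ℕ) :
    ultraCoeff lam (fun x => p.eval x + s * g.eval x + t * q.eval x) n =
      ultraCoeff lam (fun x => p.eval x) n + s * ultraCoeff lam (fun x => g.eval x) n
        + t * ultraCoeff lam (fun x => q.eval x) n := by
  have h : ∀ r : ℝ[X], Integrable (fun x => r.eval x * ultraBasis lam n x) (ultraMeasure lam) :=
    fun r => integrable_of_continuousOn hlam
      (r.continuous.mul (continuous_ultraBasis lam n)).continuousOn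
  simp only [ultraCoeff, ultraInner, add_mul, mul_assoc]
  have hpg : Integrable (fun x => p.eval x * ultraBasis lam n x
      + s * (g.eval x * ultraBasis lam n x)) (ultraMeasure lam) := (h p).add ((h g).const_mul s)
  rw [integral_add hpg ((h q).const_mul t), integral_add (h p) ((h g).const_mul s),
    integral_const_mul, integral_const_mul]

/-- Positivity of `(A_σ^λ)⁻¹` on a polynomial that has degree below `N`. -/
theorem inverse_nonneg_of_expansion {lam σ : ℝ} (hlam : 0 < lam) (hσ0 : 0 < σ) (hσ1 : σ < 1)
    {N : ℕ} {f : ℝ → ℝ}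
    (hf : ∀ x, f x = ∑ n ∈ Finset.range N, ultraCoeff lam f n * ultraBasis lam n x)
    (hpos : ∀ x ∈ Set.Icc (-1 : ℝ) 1, 0 ≤ f x) {x : ℝ} (hx : x ∈ Set.Icc (-1 : ℝ) 1) :
    0 ≤ ∑ n ∈ Finset.range N,
      ultraCoeff lam f n / ultraMultiplier lam σ n * ultraBasis lam n x := by
  have h := inverse_nonneg hlam hσ0 hσ1 N (fun n => ultraCoeff lam f n / ultraPolyNorm lam n)
    (fun y hy => by
      refine (hpos y hy).trans_eq ((hf y).trans ?_)
      refine Finset.sum_congr rfl fun n _ => ?_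
      rw [ultraBasis]
      ring) hx
  refine h.trans_eq (Finset.sum_congr rfl fun n _ => ?_)
  rw [ultraBasis]
  ring

/-- The ground state (Schur test) estimate for the quadratic form of `(A_σ^λ)⁻¹`: positivity
applied to `φ - 2 t g + t² q` with `t = g(x) / q(x)` gives
`⟨g, A⁻¹ g⟩ ≤ ⟨φ, A⁻¹ q⟩`, and `⟨A⁻¹ φ, q⟩ ≤ ⟨A⁻¹ φ, V w⟩ = Q⁻¹ ⟨φ, w⟩`. -/
theorem sum_sq_div_multiplier_le {lam σ : ℝ} (hlam : 0 < lam) (hσ0 : 0 < σ) (hσ1 : σ < 1)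
    (g q φ : ℝ[X]) (hq : ∀ x ∈ Set.Icc (-1 : ℝ) 1, 0 < q.eval x)
    (hqh : ∀ x ∈ Set.Ioo (-1 : ℝ) 1, q.eval x ≤ (1 - x ^ 2) ^ (-(2 * lam + 1 + σ) / 4))
    (hφ : ∀ x ∈ Set.Icc (-1 : ℝ) 1, g.eval x ^ 2 ≤ φ.eval x * q.eval x) (M : ℕ) :
    ultraHardyConst lam σ * ∑ n ∈ Finset.range M,
        ultraCoeff lam (fun x => g.eval x) n ^ 2 / ultraMultiplier lam σ n ≤
      ∫ x, φ.eval x * (1 - x ^ 2) ^ (-(2 * lam + 1 - σ) / 4) ∂(ultraMeasure lam) := by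
  obtain ⟨N₁, h₁⟩ := exists_expansion hlam g
  obtain ⟨N₂, h₂⟩ := exists_expansion hlam q
  obtain ⟨N₃, h₃⟩ := exists_expansion hlam φ
  set N := max M (max N₁ (max N₂ N₃)) with hN
  replace h₁ := h₁ N (by omega)
  replace h₂ := h₂ N (by omega)
  replace h₃ := h₃ N (by omega)
  set G := ultraCoeff lam (fun x => g.eval x) with hG
  set K := ultraCoeff lam (fun x => q.eval x) with hK
  set F := ultraCoeff lam (fun x => φ.eval x) with hF
  set m := ultraMultiplier lam σ with hm
  have hm0 : ∀ n, 0 < m n := ultraMultiplier_pos hlam hσ0 hσ1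
  have hQ := ultraHardyConst_pos hlam hσ0 hσ1
  have hcont : ∀ k : ℕ → ℝ,
      Continuous fun x => ∑ n ∈ Finset.range N, k n * ultraBasis lam n x := fun k =>
    continuous_finsetSum _ fun n _ => (continuous_ultraBasis lam n).const_mul _
  have hφ0 : ∀ x ∈ Set.Icc (-1 : ℝ) 1, 0 ≤ φ.eval x := fun x hx =>
    nonneg_of_mul_nonneg_left ((sq_nonneg _).trans (hφ x hx)) (hq x hx)
  have hBφ := fun x hx => inverse_nonneg_of_expansion hlam hσ0 hσ1 h₃ hφ0 (x := x) hx
  have hBq := fun x hx =>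
    inverse_nonneg_of_expansion hlam hσ0 hσ1 h₂ (fun y hy => (hq y hy).le) (x := x) hx
  set Bg : ℝ → ℝ := fun x => ∑ n ∈ Finset.range N, G n / m n * ultraBasis lam n x with hBg_def
  set Bq : ℝ → ℝ := fun x => ∑ n ∈ Finset.range N, K n / m n * ultraBasis lam n x with hBq_def
  set Bφ : ℝ → ℝ := fun x => ∑ n ∈ Finset.range N, F n / m n * ultraBasis lam n x with hBφ_def
  have hpoint : ∀ x ∈ Set.Icc (-1 : ℝ) 1,
      2 * (g.eval x * Bg x) ≤ q.eval x * Bφ x + φ.eval x * Bq x := by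
    intro x hx
    set t := g.eval x / q.eval x with ht
    have hqx := hq x hx
    have hcomb : ∀ n, ultraCoeff lam
        (fun y => φ.eval y + (-2 * t) * g.eval y + t ^ 2 * q.eval y) n =
        F n + (-2 * t) * G n + t ^ 2 * K n := ultraCoeff_combination hlam φ g q _ _
    have h := inverse_nonneg_of_expansion hlam hσ0 hσ1 (N := N)
      (f := fun y => φ.eval y + (-2 * t) * g.eval y + t ^ 2 * q.eval y) (fun y => by
        simp only [hcomb]
        rw [h₁, h₂, h₃, Finset.mul_sum, Finset.mul_sum, ← Finset.sum_add_distrib,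
          ← Finset.sum_add_distrib]
        exact Finset.sum_congr rfl fun n _ => by ring) (fun y hy => by
        have h1 := hφ y hy
        have h2 := hq y hy
        refine nonneg_of_mul_nonneg_left ?_ h2
        nlinarith [sq_nonneg (g.eval y - t * q.eval y)]) hx
    have hsum : ∑ n ∈ Finset.range N, ultraCoeff lam
        (fun y => φ.eval y + (-2 * t) * g.eval y + t ^ 2 * q.eval y) n
          / m n * ultraBasis lam n x = Bφ x + (-2 * t) * Bg x + t ^ 2 * Bq x := by
      simp only [hBg_def, hBq_def, hBφ_def, Finset.mul_sum, ← Finset.sum_add_distrib, hcomb]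
      exact Finset.sum_congr rfl fun n _ => by ring
    rw [hsum] at h
    have e1 : q.eval x * t = g.eval x := mul_div_cancel₀ _ hqx.ne'
    have e2 : q.eval x * t ^ 2 ≤ φ.eval x := by
      refine le_of_mul_le_mul_right ?_ hqx
      calc q.eval x * t ^ 2 * q.eval x = g.eval x ^ 2 := by rw [← e1]; ring
        _ ≤ _ := hφ x hx
    have h3 := mul_nonneg hqx.le h
    have h4 := mul_le_mul_of_nonneg_right e2 (hBq x hx)
    have h5 : q.eval x * (Bφ x + (-2 * t) * Bg x + t ^ 2 * Bq x) =
        q.eval x * Bφ x - 2 * (g.eval x * Bg x) + q.eval x * t ^ 2 * Bq x := by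
      rw [← e1]; ring
    linarith
  have hint : ∀ (r : ℝ[X]) (k : ℕ → ℝ), Integrable
      (fun x => r.eval x * ∑ n ∈ Finset.range N, k n * ultraBasis lam n x) (ultraMeasure lam) :=
    fun r k => integrable_of_continuousOn hlam (r.continuous.mul (hcont k)).continuousOn
  have hinner : ∀ (r : ℝ[X]) (k : ℕ → ℝ),
      ∫ x, r.eval x * ∑ n ∈ Finset.range N, k n * ultraBasis lam n x ∂(ultraMeasure lam) =
        ∑ n ∈ Finset.range N, k n * ultraCoeff lam (fun x => r.eval x) n := fun r k =>
    ultraInner_sum (fun n => integrable_of_continuousOn hlam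
      (r.continuous.mul (continuous_ultraBasis lam n)).continuousOn) N k
  have hstep1 : ∑ n ∈ Finset.range N, G n ^ 2 / m n ≤ ∫ x, q.eval x * Bφ x ∂(ultraMeasure lam) := by
    have h := integral_mono_ae ((hint g _).const_mul 2) ((hint q _).add (hint φ _))
      ((ae_mem_Ioo lam).mono fun x hx => hpoint x ⟨hx.1.le, hx.2.le⟩)
    simp only [Pi.add_apply] at h
    rw [integral_const_mul, integral_add (hint q _) (hint φ _), hinner, hinner, hinner] at h
    rw [hinner]
    have e1 : ∑ n ∈ Finset.range N, G n / m n * G n = ∑ n ∈ Finset.range N, G n ^ 2 / m n :=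
      Finset.sum_congr rfl fun n _ => by ring
    have e2 : ∑ n ∈ Finset.range N, K n / m n * F n = ∑ n ∈ Finset.range N, F n / m n * K n :=
      Finset.sum_congr rfl fun n _ => by ring
    simp only [← hG, ← hK, ← hF, e1, e2] at h ⊢
    linarith
  have hpow_int : ∀ b : ℝ, -1 < lam - 1 / 2 + b → ∀ f : ℝ → ℝ, Continuous f →
      Integrable (fun x => (1 - x ^ 2) ^ b * f x) (ultraMeasure lam) := fun b hb f hf => by
    simpa only [mul_comm] using integrable_mul_one_sub_sq_rpow hb hf.continuousOn
  have hstep2 : ∫ x, q.eval x * Bφ x ∂(ultraMeasure lam) ≤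
      ∫ x, (1 - x ^ 2) ^ (-(2 * lam + 1 + σ) / 4) * Bφ x ∂(ultraMeasure lam) := by
    refine integral_mono_ae (hint q _) (hpow_int _ (by linarith) _ (hcont _)) ?_
    filter_upwards [ae_mem_Ioo lam] with x hx
    exact mul_le_mul_of_nonneg_right (hqh x hx) (hBφ x ⟨hx.1.le, hx.2.le⟩)
  have hstep3 : ultraHardyConst lam σ *
      ∫ x, (1 - x ^ 2) ^ (-(2 * lam + 1 + σ) / 4) * Bφ x ∂(ultraMeasure lam) =
      ∫ x, φ.eval x * (1 - x ^ 2) ^ (-(2 * lam + 1 - σ) / 4) ∂(ultraMeasure lam) := by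
    have e1 := ultraInner_sum (fun n => hpow_int (-(2 * lam + 1 + σ) / 4) (by linarith) _
      (continuous_ultraBasis lam n)) N (fun n => F n / m n)
    have e2 := ultraInner_sum (fun n => hpow_int (-(2 * lam + 1 - σ) / 4) (by linarith) _
      (continuous_ultraBasis lam n)) N F
    simp only [ultraInner, ← h₃] at e1 e2
    simp only [mul_comm (φ.eval _)]
    rw [e1, e2, Finset.mul_sum]
    refine Finset.sum_congr rfl fun n _ => ?_
    have := ultraCoeff_groundState hlam hσ0 hσ1 n
    have hmn := (hm0 n).ne'
    rw [mul_left_comm, this]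
    change F n / m n * (m n * _) = _
    rw [← mul_assoc, div_mul_cancel₀ _ hmn]
  rw [← hstep3]
  refine mul_le_mul_of_nonneg_left (le_trans ?_ (hstep1.trans hstep2)) hQ.le
  exact Finset.sum_le_sum_of_subset_of_nonneg (Finset.range_mono (le_max_left _ _))
    fun n _ _ => div_nonneg (sq_nonneg _) (hm0 n).le

theorem exists_polynomial_between {f F : ℝ → ℝ} (hf : ContinuousOn f (Set.Icc (-1) 1))
    (hF : ContinuousOn F (Set.Icc (-1) 1)) (h : ∀ x ∈ Set.Icc (-1 : ℝ) 1, f x < F x) :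
    ∃ p : ℝ[X], ∀ x ∈ Set.Icc (-1 : ℝ) 1, f x < p.eval x ∧ p.eval x < F x := by
  obtain ⟨z, hz, hmin⟩ := isCompact_Icc.exists_isMinOn ⟨(0 : ℝ), by simp⟩ (hF.sub hf)
  obtain ⟨p, hp⟩ := exists_polynomial_near_of_continuousOn (-1) 1 (fun x => (f x + F x) / 2)
    ((hf.add hF).div_const 2) ((F z - f z) / 2) (by linarith [h z hz])
  refine ⟨p, fun x hx => ?_⟩
  have h1 := abs_lt.1 (hp x hx)
  have h2 : F z - f z ≤ F x - f x := hmin hx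
  constructor <;> linarith [h1.1, h1.2]

/-- The dual Hardy inequality `Q ⟨g, A⁻¹ g⟩ ≤ ∫ g² / V` for polynomials. -/
theorem dual_inequality_polynomial {lam σ : ℝ} (hlam : 0 < lam) (hσ0 : 0 < σ) (hσ1 : σ < 1)
    (g : ℝ[X]) (M : ℕ) :
    ultraHardyConst lam σ * ∑ n ∈ Finset.range M,
        ultraCoeff lam (fun x => g.eval x) n ^ 2 / ultraMultiplier lam σ n ≤
      ∫ x, g.eval x ^ 2 * (1 - x ^ 2) ^ (σ / 2) ∂(ultraMeasure lam) := by
  have hkc : Continuous fun x : ℝ => (1 - x ^ 2) ^ ((2 * lam + 1 + σ) / 4) :=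
    Continuous.rpow_const (by fun_prop) fun x => Or.inr (by positivity)
  have hk0 : ∀ x ∈ Set.Icc (-1 : ℝ) 1, 0 ≤ (1 - x ^ 2) ^ ((2 * lam + 1 + σ) / 4) := fun x hx =>
    Real.rpow_nonneg (by nlinarith [hx.1, hx.2]) _
  have hgc : ContinuousOn (fun x => g.eval x ^ 2) (Set.Icc (-1) 1) := by fun_prop
  have hi1 := integrable_mul_one_sub_sq_rpow (lam := lam) (b := σ / 2) (by linarith) hgc
  have hi2 := integrable_mul_one_sub_sq_rpow (lam := lam) (b := -(2 * lam + 1 - σ) / 4)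
    (by linarith) hgc
  set I := ∫ x, g.eval x ^ 2 * (1 - x ^ 2) ^ (-(2 * lam + 1 - σ) / 4) ∂(ultraMeasure lam) with hI
  -- polynomial substitutes for `1 / (V w)` and for `V w`, up to an error `ε`
  have key : ∀ ε > 0, ultraHardyConst lam σ * ∑ n ∈ Finset.range M,
        ultraCoeff lam (fun x => g.eval x) n ^ 2 / ultraMultiplier lam σ n ≤
      ∫ x, g.eval x ^ 2 * (1 - x ^ 2) ^ (σ / 2) ∂(ultraMeasure lam) + 2 * ε * I := by
    intro ε hε
    obtain ⟨ψ, hψ⟩ := exists_polynomial_between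
      (f := fun x => (1 - x ^ 2) ^ ((2 * lam + 1 + σ) / 4) + ε)
      (F := fun x => (1 - x ^ 2) ^ ((2 * lam + 1 + σ) / 4) + 2 * ε)
      (hkc.add_const _).continuousOn (hkc.add_const _).continuousOn (fun x _ => by linarith)
    obtain ⟨q, hq⟩ := exists_polynomial_between
      (f := fun x => ((1 - x ^ 2) ^ ((2 * lam + 1 + σ) / 4) + ε)⁻¹)
      (F := fun x => ((1 - x ^ 2) ^ ((2 * lam + 1 + σ) / 4) + ε / 2)⁻¹)
      (ContinuousOn.inv₀ (hkc.add_const _).continuousOn fun x hx => by linarith [hk0 x hx])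
      (ContinuousOn.inv₀ (hkc.add_const _).continuousOn fun x hx => by linarith [hk0 x hx])
      (fun x hx => by
        have := hk0 x hx
        exact inv_strictAnti₀ (by linarith) (by linarith))
    have hqpos : ∀ x ∈ Set.Icc (-1 : ℝ) 1, 0 < q.eval x := fun x hx =>
      (inv_pos.2 (by linarith [hk0 x hx])).trans (hq x hx).1
    refine (sum_sq_div_multiplier_le hlam hσ0 hσ1 g q (g ^ 2 * ψ) hqpos ?_ ?_ M).trans ?_
    · intro x hx
      have hpos : 0 < 1 - x ^ 2 := by nlinarith [hx.1, hx.2]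
      rw [neg_div, Real.rpow_neg hpos.le]
      refine (hq x ⟨hx.1.le, hx.2.le⟩).2.le.trans ?_
      exact inv_anti₀ (Real.rpow_pos_of_pos hpos _) (by linarith)
    · intro x hx
      have hk := hk0 x hx
      have h1 : 1 ≤ ψ.eval x * q.eval x := by
        have hne : (1 - x ^ 2) ^ ((2 * lam + 1 + σ) / 4) + ε ≠ 0 := by linarith
        rw [← mul_inv_cancel₀ hne]
        exact mul_le_mul (hψ x hx).1.le (hq x hx).1.le (inv_nonneg.2 (by linarith))
          (by linarith [(hψ x hx).1])
      simp only [Polynomial.eval_mul, Polynomial.eval_pow, mul_assoc]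
      exact le_mul_of_one_le_right (sq_nonneg _) h1
    · rw [hI, ← integral_const_mul, ← integral_add hi1 (hi2.const_mul _)]
      refine integral_mono_ae (integrable_mul_one_sub_sq_rpow (by linarith)
        (Polynomial.continuous _).continuousOn) (hi1.add (hi2.const_mul _)) ?_
      filter_upwards [ae_mem_Ioo lam] with x hx
      have hpos : 0 < 1 - x ^ 2 := by nlinarith [hx.1, hx.2]
      have hw : (1 - x ^ 2) ^ (σ / 2) = (1 - x ^ 2) ^ ((2 * lam + 1 + σ) / 4) *
          (1 - x ^ 2) ^ (-(2 * lam + 1 - σ) / 4) := by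
        rw [← Real.rpow_add hpos]
        congr 1
        ring
      have hw0 : 0 ≤ g.eval x ^ 2 * (1 - x ^ 2) ^ (-(2 * lam + 1 - σ) / 4) :=
        mul_nonneg (sq_nonneg _) (Real.rpow_nonneg hpos.le _)
      have := mul_le_mul_of_nonneg_left (hψ x ⟨hx.1.le, hx.2.le⟩).2.le hw0
      simp only [Polynomial.eval_mul, Polynomial.eval_pow, hw]
      linarith
  have ht : Tendsto (fun ε : ℝ => ∫ x, g.eval x ^ 2 * (1 - x ^ 2) ^ (σ / 2) ∂(ultraMeasure lam)
      + 2 * ε * I) (𝓝[>] 0) (𝓝 (∫ x, g.eval x ^ 2 * (1 - x ^ 2) ^ (σ / 2) ∂(ultraMeasure lam)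
      + 2 * 0 * I)) :=
    Continuous.tendsto' (by fun_prop) _ _ rfl |>.mono_left nhdsWithin_le_nhds
  rw [mul_zero, zero_mul, add_zero] at ht
  exact ge_of_tendsto ht (eventually_mem_nhdsWithin.mono key)

/-! ### From the dual inequality to the Hardy inequality -/

theorem abs_integral_mul_le {lam : ℝ} {f e : ℝ → ℝ} (hf : MemLp f 2 (ultraMeasure lam))
    (he : MemLp e 2 (ultraMeasure lam)) :
    |∫ x, f x * e x ∂(ultraMeasure lam)| ≤
      (eLpNorm f 2 (ultraMeasure lam)).toReal * (eLpNorm e 2 (ultraMeasure lam)).toReal := by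
  have h := abs_real_inner_le_norm (he.toLp e) (hf.toLp f)
  rw [L2.inner_def, Lp.norm_toLp, Lp.norm_toLp, mul_comm] at h
  refine le_trans (le_of_eq ?_) h
  congr 1
  refine integral_congr_ae ?_
  filter_upwards [hf.coeFn_toLp, he.coeFn_toLp] with x h1 h2
  simp [h1, h2]

theorem integrable_mul_of_memLp {lam : ℝ} {f g : ℝ → ℝ} (hf : MemLp f 2 (ultraMeasure lam))
    (hg : MemLp g 2 (ultraMeasure lam)) :
    Integrable (fun x => f x * g x) (ultraMeasure lam) :=
  hf.integrable_mul hg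

theorem tendsto_integral_mul {lam : ℝ} {f : ℝ → ℝ} {e : ℕ → ℝ → ℝ}
    (hf : MemLp f 2 (ultraMeasure lam)) (he : ∀ k, MemLp (e k) 2 (ultraMeasure lam))
    (h : Tendsto (fun k => eLpNorm (e k) 2 (ultraMeasure lam)) atTop (𝓝 0)) :
    Tendsto (fun k => ∫ x, f x * e k x ∂(ultraMeasure lam)) atTop (𝓝 0) := by
  have h' := ((ENNReal.tendsto_toReal ENNReal.zero_ne_top).comp h).const_mul
    (eLpNorm f 2 (ultraMeasure lam)).toReal
  rw [ENNReal.toReal_zero, mul_zero] at h'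
  exact squeeze_zero_norm (fun k => abs_integral_mul_le hf (he k)) h'

theorem tendsto_integral_sq {lam : ℝ} {e : ℕ → ℝ → ℝ}
    (he : ∀ k, MemLp (e k) 2 (ultraMeasure lam))
    (h : Tendsto (fun k => eLpNorm (e k) 2 (ultraMeasure lam)) atTop (𝓝 0)) :
    Tendsto (fun k => ∫ x, e k x ^ 2 ∂(ultraMeasure lam)) atTop (𝓝 0) := by
  have h0 := (ENNReal.tendsto_toReal ENNReal.zero_ne_top).comp h
  have h' := h0.mul h0
  rw [ENNReal.toReal_zero, mul_zero] at h'
  refine squeeze_zero_norm (fun k => ?_) h'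
  simpa only [sq] using! abs_integral_mul_le (he k) (he k)

theorem integrable_mul_ultraBasis {lam : ℝ} (hlam : 0 < lam) {f : ℝ → ℝ}
    (hf : MemLp f 2 (ultraMeasure lam)) (n : ℕ) :
    Integrable (fun x => f x * ultraBasis lam n x) (ultraMeasure lam) :=
  hf.integrable_mul (memLp_of_continuousOn hlam (continuous_ultraBasis lam n).continuousOn)

/-- The dual Hardy inequality paired with `u`, first for polynomials and then, since `1 / V` is
bounded and polynomials are dense, on all of `L²`. -/
theorem sq_integral_mul_le {lam σ : ℝ} (hlam : 0 < lam) (hσ0 : 0 < σ) (hσ1 : σ < 1)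
    {u : ℝ → ℝ} (hu : MemLp u 2 (ultraMeasure lam)) {E : ℝ}
    (hE : HasSum (fun n : ℕ => ultraMultiplier lam σ n * ultraCoeff lam u n ^ 2) E)
    {g : ℝ → ℝ} (hg : MemLp g 2 (ultraMeasure lam)) :
    ultraHardyConst lam σ * (∫ x, u x * g x ∂(ultraMeasure lam)) ^ 2 ≤
      E * ∫ x, g x ^ 2 * (1 - x ^ 2) ^ (σ / 2) ∂(ultraMeasure lam) := by
  have hQ := ultraHardyConst_pos hlam hσ0 hσ1
  have hm0 := ultraMultiplier_pos hlam hσ0 hσ1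
  have hpoly : ∀ p : ℝ[X],
      ultraHardyConst lam σ * (∫ x, u x * p.eval x ∂(ultraMeasure lam)) ^ 2 ≤
        E * ∫ x, p.eval x ^ 2 * (1 - x ^ 2) ^ (σ / 2) ∂(ultraMeasure lam) := by
    intro p
    obtain ⟨N, hN⟩ := exists_expansion hlam p
    have h1 := ultraInner_sum (integrable_mul_ultraBasis hlam hu) N
      (ultraCoeff lam (fun y => p.eval y))
    simp only [ultraInner, ← hN N le_rfl] at h1
    have h2 := dual_inequality_polynomial hlam hσ0 hσ1 p N
    have h3 : ∑ n ∈ Finset.range N, ultraMultiplier lam σ n * ultraCoeff lam u n ^ 2 ≤ E :=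
      sum_le_hasSum _ (fun n _ => mul_nonneg (hm0 n).le (sq_nonneg _)) hE
    have h4 := Finset.sum_sq_le_sum_mul_sum_of_sq_le_mul (Finset.range N)
      (r := fun n => ultraCoeff lam (fun y => p.eval y) n * ultraCoeff lam u n)
      (f := fun n => ultraMultiplier lam σ n * ultraCoeff lam u n ^ 2)
      (g := fun n => ultraCoeff lam (fun y => p.eval y) n ^ 2 / ultraMultiplier lam σ n)
      (fun n _ => mul_nonneg (hm0 n).le (sq_nonneg _))
      (fun n _ => div_nonneg (sq_nonneg _) (hm0 n).le)
      (fun n _ => le_of_eq (by have := (hm0 n).ne'; field_simp))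
    have hs0 : 0 ≤ ∑ n ∈ Finset.range N,
        ultraCoeff lam (fun y => p.eval y) n ^ 2 / ultraMultiplier lam σ n :=
      Finset.sum_nonneg fun n _ => div_nonneg (sq_nonneg _) (hm0 n).le
    have hE0 : 0 ≤ E := hE.nonneg fun n => mul_nonneg (hm0 n).le (sq_nonneg _)
    rw [h1]
    refine (mul_le_mul_of_nonneg_left
      (h4.trans (mul_le_mul_of_nonneg_right h3 hs0)) hQ.le).trans ?_
    rw [mul_left_comm]
    exact mul_le_mul_of_nonneg_left h2 hE0
  have hε : ∀ k : ℕ, ((k : ENNReal) + 1)⁻¹ ≠ 0 := fun k => by simp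
  choose p hp using fun k => exists_polynomial_eLpNorm_sub_le hlam hg (hε k)
  have hpm : ∀ k, MemLp (fun x => (p k).eval x) 2 (ultraMeasure lam) := fun k =>
    memLp_of_continuousOn hlam (p k).continuous.continuousOn
  have hem : ∀ k, MemLp (fun x => g x - (p k).eval x) 2 (ultraMeasure lam) := fun k =>
    hg.sub (hpm k)
  have htend : Tendsto (fun k => eLpNorm (fun x => g x - (p k).eval x) 2 (ultraMeasure lam))
      atTop (𝓝 0) := by
    refine tendsto_of_tendsto_of_tendsto_of_le_of_le tendsto_const_nhds ?_ (fun _ => zero_le) hp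
    have := (tendsto_add_atTop_iff_nat 1).2 ENNReal.tendsto_inv_nat_nhds_zero
    simpa using this
  have hW : ∀ᵐ x ∂(ultraMeasure lam), ‖(1 - x ^ 2) ^ (σ / 2)‖ ≤ 1 := by
    filter_upwards [ae_mem_Ioo lam] with x hx
    have hpos : 0 ≤ 1 - x ^ 2 := by nlinarith [hx.1, hx.2]
    rw [Real.norm_of_nonneg (Real.rpow_nonneg hpos _)]
    exact Real.rpow_le_one hpos (by nlinarith [sq_nonneg x]) (by linarith)
  have hWm : AEStronglyMeasurable (fun x : ℝ => (1 - x ^ 2) ^ (σ / 2)) (ultraMeasure lam) :=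
    Measurable.aestronglyMeasurable (by fun_prop)
  have hsq : ∀ {f : ℝ → ℝ}, MemLp f 2 (ultraMeasure lam) →
      Integrable (fun x => f x ^ 2 * (1 - x ^ 2) ^ (σ / 2)) (ultraMeasure lam) := fun hf =>
    hf.integrable_sq.mul_bdd (c := 1) hWm hW
  have hgW : MemLp (fun x => g x * (1 - x ^ 2) ^ (σ / 2)) 2 (ultraMeasure lam) := by
    refine hg.of_le_mul (c := 1) (hg.1.mul hWm) ?_
    filter_upwards [hW] with x hx
    rw [norm_mul, one_mul]
    exact mul_le_of_le_one_right (norm_nonneg _) hx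
  have t1 : Tendsto (fun k => ∫ x, u x * (p k).eval x ∂(ultraMeasure lam)) atTop
      (𝓝 (∫ x, u x * g x ∂(ultraMeasure lam))) := by
    have h := (tendsto_integral_mul hu hem htend).const_sub (∫ x, u x * g x ∂(ultraMeasure lam))
    rw [sub_zero] at h
    refine h.congr fun k => ?_
    rw [← integral_sub (integrable_mul_of_memLp hu hg) (integrable_mul_of_memLp hu (hem k))]
    congr 1
    ext x
    ring
  have t2 : Tendsto (fun k => ∫ x, (p k).eval x ^ 2 * (1 - x ^ 2) ^ (σ / 2) ∂(ultraMeasure lam))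
      atTop (𝓝 (∫ x, g x ^ 2 * (1 - x ^ 2) ^ (σ / 2) ∂(ultraMeasure lam))) := by
    have ha := (tendsto_integral_mul hgW hem htend).const_mul 2
    have hb : Tendsto (fun k => ∫ x, (g x - (p k).eval x) ^ 2 * (1 - x ^ 2) ^ (σ / 2)
        ∂(ultraMeasure lam)) atTop (𝓝 0) := by
      refine squeeze_zero_norm (fun k => ?_) (tendsto_integral_sq hem htend)
      refine norm_integral_le_of_norm_le (hem k).integrable_sq ?_
      filter_upwards [hW] with x hx
      rw [norm_mul, Real.norm_of_nonneg (sq_nonneg (g x - (p k).eval x))]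
      exact mul_le_of_le_one_right (sq_nonneg _) hx
    have h := (hb.sub ha).const_add (∫ x, g x ^ 2 * (1 - x ^ 2) ^ (σ / 2) ∂(ultraMeasure lam))
    rw [mul_zero, sub_zero, add_zero] at h
    refine h.congr fun k => ?_
    have h2 := (integrable_mul_of_memLp hgW (hem k)).const_mul 2
    have h3 := (hsq (hem k)).sub h2
    simp only [Pi.sub_def] at h3
    rw [← integral_const_mul, ← integral_sub (hsq (hem k)) h2, ← integral_add (hsq hg) h3]
    congr 1
    ext x
    ring
  exact le_of_tendsto_of_tendsto' ((t1.pow 2).const_mul _) (t2.const_mul _) fun k => hpoly (p k)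

/-- The Hardy inequality in terms of the spectral sum `E`. With `g` the truncation of `V u` to
`S_k`, `V = (1 - x²) ^ (-σ / 2)`, the dual inequality reads `Q T_k² ≤ E T_k` for
`T_k = ∫_{S_k} u² V`, hence `Q T_k ≤ E`, and `S_k` exhausts `(-1, 1)`. -/
theorem hardy_inequality {lam σ : ℝ} (hlam : 0 < lam) (hσ0 : 0 < σ) (hσ1 : σ < 1)
    {u : ℝ → ℝ} (hu : MemLp u 2 (ultraMeasure lam)) {E : ℝ}
    (hE : HasSum (fun n : ℕ => ultraMultiplier lam σ n * ultraCoeff lam u n ^ 2) E) :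
    Integrable (fun x => u x ^ 2 / (1 - x ^ 2) ^ (σ / 2)) (ultraMeasure lam) ∧
      ultraHardyConst lam σ *
        ∫ x, u x ^ 2 / (1 - x ^ 2) ^ (σ / 2) ∂(ultraMeasure lam) ≤ E := by
  have hQ := ultraHardyConst_pos hlam hσ0 hσ1
  have hE0 : 0 ≤ E := hE.nonneg fun n =>
    mul_nonneg (ultraMultiplier_pos hlam hσ0 hσ1 n).le (sq_nonneg _)
  set S : ℕ → Set ℝ := fun k => {x | (1 : ℝ) / (k + 1) ≤ 1 - x ^ 2} with hS
  have hSm : ∀ k, MeasurableSet (S k) := fun k => measurableSet_le (by fun_prop) (by fun_prop)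
  have hcover : AECover (ultraMeasure lam) atTop S := by
    refine ⟨?_, hSm⟩
    filter_upwards [ae_mem_Ioo lam] with x hx
    have hpos : 0 < 1 - x ^ 2 := by nlinarith [hx.1, hx.2]
    exact (tendsto_one_div_add_atTop_nhds_zero_nat.eventually_le_const hpos)
  have hpos : ∀ k, ∀ x ∈ S k, 0 < 1 - x ^ 2 := fun k x hx =>
    (by positivity : (0 : ℝ) < 1 / (k + 1)).trans_le hx
  -- test the dual inequality with `V u`, truncated away from the end points
  set g : ℕ → ℝ → ℝ := fun k => (S k).indicator fun x => u x / (1 - x ^ 2) ^ (σ / 2) with hg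
  have hgm : ∀ k, MemLp (g k) 2 (ultraMeasure lam) := by
    intro k
    refine hu.of_le_mul (c := ((k : ℝ) + 1) ^ (σ / 2)) ?_ (ae_of_all _ fun x => ?_)
    · refine AEStronglyMeasurable.indicator ?_ (hSm k)
      simp only [div_eq_mul_inv]
      exact hu.1.mul (Measurable.aestronglyMeasurable (by fun_prop))
    · by_cases hx : x ∈ S k
      · rw [hg]
        simp only [Set.indicator_of_mem hx]
        have h0 := hpos k x hx
        rw [norm_div, div_eq_inv_mul, Real.norm_of_nonneg (Real.rpow_nonneg h0.le _),
          ← Real.inv_rpow h0.le]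
        refine mul_le_mul_of_nonneg_right ?_ (norm_nonneg _)
        refine Real.rpow_le_rpow (inv_nonneg.2 h0.le) ?_ (by linarith)
        exact inv_le_of_inv_le₀ (by positivity) (by simpa [hS] using hx)
      · rw [hg]
        simp only [Set.indicator_of_notMem hx, norm_zero]
        positivity
  have hug : ∀ k, (fun x => u x * g k x) =
      (S k).indicator fun x => u x ^ 2 / (1 - x ^ 2) ^ (σ / 2) := by
    intro k
    ext x
    by_cases hx : x ∈ S k
    · simp only [hg, Set.indicator_of_mem hx]; ring
    · simp [hg, Set.indicator_of_notMem hx]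
  have hgg : ∀ k, (fun x => g k x ^ 2 * (1 - x ^ 2) ^ (σ / 2)) =
      (S k).indicator fun x => u x ^ 2 / (1 - x ^ 2) ^ (σ / 2) := by
    intro k
    ext x
    by_cases hx : x ∈ S k
    · have := (Real.rpow_pos_of_pos (hpos k x hx) (σ / 2)).ne'
      simp only [hg, Set.indicator_of_mem hx]
      field_simp
    · simp [hg, Set.indicator_of_notMem hx]
  have hint : ∀ k, IntegrableOn (fun x => u x ^ 2 / (1 - x ^ 2) ^ (σ / 2)) (S k)
      (ultraMeasure lam) := by
    intro k
    rw [← integrable_indicator_iff (hSm k), ← hug]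
    exact integrable_mul_of_memLp hu (hgm k)
  have hnn : ∀ᵐ x ∂(ultraMeasure lam), 0 ≤ u x ^ 2 / (1 - x ^ 2) ^ (σ / 2) := by
    filter_upwards [ae_mem_Ioo lam] with x hx
    exact div_nonneg (sq_nonneg _) (Real.rpow_nonneg (by nlinarith [hx.1, hx.2]) _)
  have hbound : ∀ k, ∫ x in S k, u x ^ 2 / (1 - x ^ 2) ^ (σ / 2) ∂(ultraMeasure lam) ≤
      E / ultraHardyConst lam σ := by
    intro k
    have h := sq_integral_mul_le hlam hσ0 hσ1 hu hE (hgm k)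
    rw [hug, hgg, integral_indicator (hSm k)] at h
    set T := ∫ x in S k, u x ^ 2 / (1 - x ^ 2) ^ (σ / 2) ∂(ultraMeasure lam)
    rw [le_div_iff₀ hQ]
    by_contra! hlt
    have hT : 0 < T := by
      by_contra! hT
      nlinarith
    nlinarith
  have hI := hcover.integrable_of_integral_bounded_of_nonneg_ae _ hint hnn (.of_forall hbound)
  refine ⟨hI, ?_⟩
  have := le_of_tendsto' (hcover.integral_tendsto_of_countably_generated hI) hbound
  rwa [le_div_iff₀ hQ, mul_comm] at this

theorem summable_multiplier {lam σ : ℝ} (hlam : 0 < lam) (hσ0 : 0 < σ) (hσ1 : σ < 1)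
    {u : ℝ → ℝ} (hu : u ∈ ultraSobolev lam σ) :
    Summable fun n : ℕ => ultraMultiplier lam σ n * ultraCoeff lam u n ^ 2 := by
  refine Summable.of_nonneg_of_le
    (fun n => mul_nonneg (ultraMultiplier_pos hlam hσ0 hσ1 n).le (sq_nonneg _)) (fun n => ?_)
    (hu.2.mul_left ((1 + 1 / lam) ^ σ))
  rw [← mul_assoc]
  exact mul_le_mul_of_nonneg_right (ultraMultiplier_le hlam hσ0 hσ1 n) (sq_nonneg _)

end Ultraspherical

open Ultraspherical

theorem theorem1 (lam σ : ℝ) (hlam : 0 < lam) (hσ0 : 0 < σ) (hσ1 : σ < 1)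
    (u : ℝ → ℝ) (hu : u ∈ ultraSobolev lam σ) :
    Integrable (fun x => u x ^ 2 / (1 - x ^ 2) ^ (σ / 2)) (ultraMeasure lam) ∧
    ∃ E : ℝ,
      Tendsto (fun N : ℕ => ultraInner lam u (ultraOpPartial lam σ u N)) atTop (𝓝 E) ∧
      HasSum (fun n : ℕ => ultraMultiplier lam σ n * ultraCoeff lam u n ^ 2) E ∧
      (∀ v : ℝ → ℝ, IsUltraOp lam σ u v → ultraInner lam u v = E) ∧
      ultraHardyConst lam σ *
        ∫ x, u x ^ 2 / (1 - x ^ 2) ^ (σ / 2) ∂(ultraMeasure lam) ≤ E := by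
  have hE := (summable_multiplier hlam hσ0 hσ1 hu).hasSum
  obtain ⟨hI, hle⟩ := hardy_inequality hlam hσ0 hσ1 hu.1 hE
  have ht : Tendsto (fun N : ℕ => ultraInner lam u (ultraOpPartial lam σ u N)) atTop
      (𝓝 (∑' n, ultraMultiplier lam σ n * ultraCoeff lam u n ^ 2)) := by
    refine hE.tendsto_sum_nat.congr fun N => ?_
    have h := ultraInner_sum (integrable_mul_ultraBasis hlam hu.1) N
      (fun n => ultraMultiplier lam σ n * ultraCoeff lam u n)
    refine Eq.trans ?_ h.symm
    exact Finset.sum_congr rfl fun n _ => by ring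
  refine ⟨hI, _, ht, hE, fun v hv => ?_, hle⟩
  have hSm : ∀ N, MemLp (ultraOpPartial lam σ u N) 2 (ultraMeasure lam) := fun N =>
    memLp_of_continuousOn hlam (Continuous.continuousOn
      (continuous_finsetSum _ fun n _ => (continuous_ultraBasis lam n).const_mul _))
  have h := tendsto_integral_mul hu.1 (fun N => (hSm N).sub hv.1) hv.2
  have h' := h.add_const (ultraInner lam u v)
  rw [zero_add] at h'
  refine tendsto_nhds_unique (h'.congr fun N => ?_) ht
  simp only [ultraInner]
  rw [← integral_add (integrable_mul_of_memLp hu.1 ((hSm N).sub hv.1))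
    (integrable_mul_of_memLp hu.1 hv.1)]
  congr 1
  ext x
  simp only [Pi.sub_apply]
  ring
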